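/- Let $H$ and $H_1,\dots,H_m$ be finite-dimensional Euclidean spaces equipped with Lebesgue measure, and let $\mathbf p=(p_1,\dots,p_m)$ be real exponents with $0\le p_j\le 1$. For linear maps $\mathbf L=(L_j)_{j=1}^m$, $L_j:H\to H_j$, let $\mathrm{BL}(\mathbf L,\mathbf p)\in[0,\infty]$ be the smallest constant $C$ for which $$\int_H\prod_{j=1}^m (f_j\circ L_j)^{p_j}\le C\prod_{j=1}^m\Big(\int_{H_j}f_j\Big)^{p_j}$$ holds for all nonnegative $f_j\in L^1(H_j)$, $1\le j\le m$ (with the convention $0^0=1$). Call $(\mathbf L,\mathbf p)$ a Brascamp--Lieb datum if every $L_j$ is surjective, and let $\|\mathbf L\|=\max_j\|L_j\|$, with operator norms. Suppose that $(\mathbf L^0,\mathbf p)$ is a Brascamp--Lieb datum with $\mathrm{BL}(\mathbf L^0,\mathbf p)<\infty$. Then there exist $\delta>0$ and $C<\infty$ such that $$\mathrm{BL}(\mathbf L,\mathbf p)\le C\qquad\text{whenever }\|\mathbf L-\mathbf L^0\|<\delta .$$ Consequently, for fixed $\mathbf p$, the finiteness set $$F(\mathbf p)=\{\mathbf L:\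 (\mathbf L,\mathbf p)\text{ is a Brascamp--Lieb datum and }\mathrm{BL}(\mathbf L,\mathbf p)<\infty\}$$ is open in the space of all $m$-tuples of linear maps $L_j:H\to H_j$, and $\mathbf L\mapsto\mathrm{BL}(\mathbf L,\mathbf p)$ is locally bounded on it. -/

import Mathlib

open MeasureTheory
open scoped ENNReal NNReal

namespace BrascampLieb

variable {ι : Type*} [Fintype ι]
  {H : Type*} [NormedAddCommGroup H] [InnerProductSpace ℝ H] [FiniteDimensional ℝ H]
  [MeasurableSpace H] [BorelSpace H]
  {E : ι → Type*} [∀ j, NormedAddCommGroup (E j)] [∀ j, InnerProductSpace ℝ (E j)]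
  [∀ j, FiniteDimensional ℝ (E j)] [∀ j, MeasurableSpace (E j)] [∀ j, BorelSpace (E j)]

/-- `(L, p)` is a Brascamp-Lieb datum: each `L j : H → E j` is a surjective linear map
(continuity is automatic in finite dimension) and each exponent `p j` lies in `[0, 1]`. -/
def IsDatum (L : ∀ j, H →L[ℝ] E j) (p : ι → ℝ) : Prop :=
  (∀ j, Function.Surjective (L j)) ∧ ∀ j, 0 ≤ p j ∧ p j ≤ 1

/-- The Brascamp-Lieb inequality with constant `C`:
`∫_H ∏ j, (f j ∘ L j) ^ p j ≤ C * ∏ j, (∫ f j) ^ p j` for all nonnegative integrable `f j`.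
The integral on the left is taken in `[0, ∞]`; the measures are the Lebesgue measures of the
Euclidean spaces `H` and `E j`. -/
def Holds (L : ∀ j, H →L[ℝ] E j) (p : ι → ℝ) (C : ℝ≥0∞) : Prop :=
  ∀ f : ∀ j, E j → ℝ, (∀ j x, 0 ≤ f j x) → (∀ j, Integrable (f j) volume) →
    ∫⁻ x : H, ∏ j, ENNReal.ofReal (f j (L j x)) ^ p j
      ≤ C * ∏ j, ENNReal.ofReal (∫ y, f j y) ^ p j

/-- The Brascamp-Lieb constant: the smallest `C` in `[0, ∞]` for which the inequality holds. -/
noncomputable def BL (L : ∀ j, H →L[ℝ] E j) (p : ι → ℝ) : ℝ≥0∞ :=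
  sInf {C : ℝ≥0∞ | Holds L p C}

/-- The finiteness set `F(p)`: all `L` such that `(L, p)` is a datum with finite
Brascamp-Lieb constant. -/
def finitenessSet (H : Type*) [NormedAddCommGroup H] [InnerProductSpace ℝ H]
    [FiniteDimensional ℝ H] [MeasurableSpace H] [BorelSpace H]
    (E : ι → Type*) [∀ j, NormedAddCommGroup (E j)] [∀ j, InnerProductSpace ℝ (E j)]
    [∀ j, FiniteDimensional ℝ (E j)] [∀ j, MeasurableSpace (E j)] [∀ j, BorelSpace (E j)]
    (p : ι → ℝ) : Set (∀ j, H →L[ℝ] E j) :=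
  {L | IsDatum L p ∧ BL L p < ∞}

end BrascampLieb

set_option linter.unusedSectionVars false

namespace BrascampLieb

/-! ### Elementary bounds for weighted geometric means. -/

section

open MeasureTheory ProbabilityTheory Filter Topology
open scoped ENNReal NNReal RealInnerProductSpace

/-! The constant is controlled through Gaussian inputs. Testing the inequality on ellipsoids
(`exists_diagonalBound_of_holds`) gives det N ≤ C ∏ det(L_j N L_j*)^{p_j} for all positive definite
N, written in an eigenbasis U of N with eigenvalues exp μ_i; this is `DiagonalBound` for every
orthogonal U.

The Gaussian bound is stable (`exists_eventually_diagonalBound`). By Cauchy-Binet, det(A D Aᵀ) is a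
sum of exponentials weighted by squared minors. Scaling μ to infinity therefore turns the bound at a
fixed U₀ into a piecewise linear inequality that sees only which minors are nonzero. Nonzero minors
stay bounded away from zero near (L⁰, U₀), so the linear inequality gives back a Gaussian bound
there, with a new constant. Compactness of the orthogonal group makes this uniform in U.

Conversely, a Gaussian bound yields the full inequality with an explicit constant
(`lintegral_prod_rpow_le_of_diagonalBound`). A Gaussian extremiser may fail to exist, so a
regularised energy is minimised instead. Its critical point equation, with the sign of the
regularisation term, says that after a change of variables S the data are geometric up to a factor 1
+ ε (`exists_almost_geometric`). With the exponents p_j/(1 + ε) the frame condition becomes exact,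
and heat flow proves the inequality for the standard Gaussian measure with constant 1
(`integral_prod_rpow_le_of_heatRegular`). Returning to Lebesgue measure on a ball of radius R costs
essentially (det SS*)^{ε/(2(1+ε))}. The log-eigenvalues of SS* are O(1/ε), so this cost stays
bounded, and its dependence on R vanishes as ε → 0. Fatou's lemma, then R → ∞, then density of test
functions complete the argument. -/

lemma abs_exp_sub_quadratic_le (u : ℝ) :
    |Real.exp u - (1 + u + u ^ 2 / 2)| ≤ |u| ^ 3 * Real.exp |u| := by
  have h := Complex.norm_exp_sub_sum_le_norm_mul_exp (u : ℂ) 3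
  have h2 : Complex.exp (u : ℂ) - ∑ m ∈ Finset.range 3, (u : ℂ) ^ m / (m.factorial : ℂ)
      = ((Real.exp u - (1 + u + u ^ 2 / 2) : ℝ) : ℂ) := by
    simp [Finset.sum_range_succ, Nat.factorial]
  rw [h2, Complex.norm_real, Complex.norm_real] at h
  simpa using h

lemma abs_log_le_div {c r : ℝ} (hc : 0 < c) (hc1 : c ≤ 1) (hr : c ≤ r) :
    |Real.log r| ≤ |r - 1| / c := by
  have hr0 : 0 < r := hc.trans_le hr
  have h1 := Real.log_le_sub_one_of_pos hr0
  have h2 := Real.one_sub_inv_le_log_of_pos hr0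
  have h3 : |r - 1| ≤ |r - 1| / c := le_div_self (abs_nonneg _) hc hc1
  have h4 : 1 - r⁻¹ = (r - 1) / r := by field_simp
  have h5 : |(r - 1) / r| ≤ |r - 1| / c := by
    rw [abs_div, abs_of_pos hr0]; gcongr
  rw [abs_le]
  constructor
  · rw [h4] at h2; linarith [neg_abs_le ((r - 1) / r)]
  · linarith [le_abs_self (r - 1)]

lemma abs_log_sub_le {c r : ℝ} (hc : 0 < c) (hr : c ≤ r) :
    |Real.log r - (r - 1)| ≤ (r - 1) ^ 2 / c := by
  have hr0 : 0 < r := hc.trans_le hr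
  have h1 := Real.log_le_sub_one_of_pos hr0
  have h2 := Real.one_sub_inv_le_log_of_pos hr0
  have h4 : 1 - r⁻¹ = (r - 1) - (r - 1) ^ 2 / r := by field_simp; ring
  have h5 : (r - 1) ^ 2 / r ≤ (r - 1) ^ 2 / c := by gcongr
  have h6 : 0 ≤ (r - 1) ^ 2 / c := by positivity
  rw [abs_le]; constructor <;> linarith

/-- Second-order expansion of a weighted geometric mean around `1`, with uniform cubic error. -/
lemma exists_prod_rpow_le_quadratic {ι : Type*} [Fintype ι] (p : ι → ℝ) (hp : ∀ j, 0 ≤ p j)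
    {c A : ℝ} (hc : 0 < c) (hc1 : c ≤ 1) (hA : 0 ≤ A) :
    ∃ K, 0 ≤ K ∧ ∀ (s : ℝ) (r l : ι → ℝ), 0 ≤ s → (∀ j, c ≤ r j) → (∀ j, r j ≤ c⁻¹) →
      (∀ j, |r j - 1| ≤ A * s) → (∀ j, |l j| ≤ A * s) → (∀ j, |r j - 1 - l j| ≤ A * s ^ 2) →
      ∏ j, r j ^ p j ≤ 1 + ∑ j, p j * (r j - 1)
        + ((∑ j, p j * l j) ^ 2 - ∑ j, p j * l j ^ 2) / 2 + K * s ^ 3 := by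
  set P := ∑ j, p j with hP
  have hP0 : 0 ≤ P := Finset.sum_nonneg fun j _ => hp j
  -- `A₁` will control |log r| / s, and `A₂` will control |log r - l| / s².
  set A₁ := A / c with hA₁
  have hA₁0 : 0 ≤ A₁ := by positivity
  have hAA₁ : A ≤ A₁ := le_div_self hA hc hc1
  set A₂ := A + A ^ 2 / c with hA₂
  have hA₂0 : 0 ≤ A₂ := by positivity
  set B := |Real.log c| with hB
  refine ⟨(P * A₁) ^ 3 * Real.exp (P * B) + P * (A₁ ^ 3 * Real.exp B)
    + (P * A₂) * (2 * P * A₁) / 2 + P * (A₂ * (2 * A₁)) / 2, by positivity, ?_⟩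
  intro s r l hs hr hr' h1 h2 h3
  have hr0 : ∀ j, 0 < r j := fun j => hc.trans_le (hr j)
  set u : ι → ℝ := fun j => Real.log (r j) with hu
  have hu1 : ∀ j, |u j| ≤ A₁ * s := fun j => by
    refine (abs_log_le_div hc hc1 (hr j)).trans ?_
    rw [hA₁, div_mul_eq_mul_div]; gcongr; exact h1 j
  have huB : ∀ j, |u j| ≤ B := fun j => by
    have e1 : Real.log c ≤ u j := Real.log_le_log hc (hr j)
    have e2 : u j ≤ - Real.log c := by
      rw [← Real.log_inv]; exact Real.log_le_log (hr0 j) (hr' j)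
    rw [hB, abs_of_nonpos (Real.log_nonpos hc.le hc1), abs_le]; constructor <;> linarith
  have hu2 : ∀ j, |u j - l j| ≤ A₂ * s ^ 2 := fun j => by
    have e1 := abs_log_sub_le hc (hr j)
    have e2 : (r j - 1) ^ 2 ≤ (A * s) ^ 2 := by
      rw [← sq_abs]; gcongr; exact h1 j
    have e3 : (r j - 1) ^ 2 / c ≤ (A * s) ^ 2 / c := by gcongr
    have e4 : u j - l j = (u j - (r j - 1)) + (r j - 1 - l j) := by ring
    rw [e4]
    refine (abs_add_le _ _).trans ((add_le_add (e1.trans e3) (h3 j)).trans (le_of_eq ?_))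
    rw [hA₂]; ring
  have hl1 : ∀ j, |l j| ≤ A₁ * s := fun j => (h2 j).trans (by gcongr)
  have sum_bound : ∀ (g : ι → ℝ) (D : ℝ), (∀ j, |g j| ≤ D) → |∑ j, p j * g j| ≤ P * D := by
    intro g D hg
    refine (Finset.abs_sum_le_sum_abs _ _).trans ?_
    rw [hP, Finset.sum_mul]
    refine Finset.sum_le_sum fun j _ => ?_
    rw [abs_mul, abs_of_nonneg (hp j)]
    exact mul_le_mul_of_nonneg_left (hg j) (hp j)
  set U := ∑ j, p j * u j with hU
  set Lm := ∑ j, p j * l j with hLm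
  have hprod : ∏ j, r j ^ p j = Real.exp U := by
    rw [hU, Real.exp_sum]
    refine Finset.prod_congr rfl fun j _ => ?_
    rw [Real.rpow_def_of_pos (hr0 j), mul_comm]
  have hU1 : |U| ≤ P * (A₁ * s) := sum_bound u _ hu1
  have hUB : |U| ≤ P * B := sum_bound u _ huB
  have hL1 : |Lm| ≤ P * (A₁ * s) := sum_bound l _ hl1
  have hUL : |U - Lm| ≤ P * (A₂ * s ^ 2) := by
    have : U - Lm = ∑ j, p j * (u j - l j) := by
      rw [hU, hLm, ← Finset.sum_sub_distrib]; exact Finset.sum_congr rfl fun j _ => by ring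
    rw [this]; exact sum_bound _ _ hu2
  have step1 : Real.exp U ≤ 1 + U + U ^ 2 / 2 + (P * (A₁ * s)) ^ 3 * Real.exp (P * B) := by
    have e1 := (abs_le.1 (abs_exp_sub_quadratic_le U)).2
    have e2 : |U| ^ 3 * Real.exp |U| ≤ (P * (A₁ * s)) ^ 3 * Real.exp (P * B) := by gcongr
    linarith
  -- The linear term is kept as r - 1 rather than log r. Since r = exp u ≥ 1 + u + u²/2 up to a
  -- cubic error, this exchange produces the negative term -∑ p u²/2 of the quadratic form.
  have step2 : U + (∑ j, p j * u j ^ 2) / 2 - P * ((A₁ * s) ^ 3 * Real.exp B)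
      ≤ ∑ j, p j * (r j - 1) := by
    have : U + (∑ j, p j * u j ^ 2) / 2 - P * ((A₁ * s) ^ 3 * Real.exp B)
        = ∑ j, p j * (u j + u j ^ 2 / 2 - (A₁ * s) ^ 3 * Real.exp B) := by
      rw [hU, hP, Finset.sum_div, ← Finset.sum_add_distrib, Finset.sum_mul,
        ← Finset.sum_sub_distrib]
      exact Finset.sum_congr rfl fun j _ => by ring
    rw [this]
    refine Finset.sum_le_sum fun j _ => mul_le_mul_of_nonneg_left ?_ (hp j)
    have e1 := (abs_le.1 (abs_exp_sub_quadratic_le (u j))).1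
    have e2 : |u j| ^ 3 * Real.exp |u j| ≤ (A₁ * s) ^ 3 * Real.exp B := by
      gcongr
      · exact hu1 j
      · exact huB j
    have e3 : Real.exp (u j) = r j := Real.exp_log (hr0 j)
    rw [e3] at e1
    linarith
  have step3 : U ^ 2 ≤ Lm ^ 2 + (P * (A₂ * s ^ 2)) * (2 * P * A₁ * s) := by
    have : U ^ 2 - Lm ^ 2 = (U - Lm) * (U + Lm) := by ring
    have e : |(U - Lm) * (U + Lm)| ≤ (P * (A₂ * s ^ 2)) * (2 * P * A₁ * s) := by
      rw [abs_mul]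
      refine mul_le_mul hUL ?_ (abs_nonneg _) (by positivity)
      refine (abs_add_le _ _).trans ((add_le_add hU1 hL1).trans (le_of_eq (by ring)))
    linarith [le_abs_self ((U - Lm) * (U + Lm))]
  have step4 : ∑ j, p j * l j ^ 2 ≤ ∑ j, p j * u j ^ 2 + P * ((A₂ * s ^ 2) * (2 * A₁ * s)) := by
    rw [hP, Finset.sum_mul, ← Finset.sum_add_distrib]
    refine Finset.sum_le_sum fun j _ => ?_
    rw [← mul_add]
    refine mul_le_mul_of_nonneg_left ?_ (hp j)
    have e : |(u j - l j) * (u j + l j)| ≤ (A₂ * s ^ 2) * (2 * A₁ * s) := by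
      rw [abs_mul]
      refine mul_le_mul (hu2 j) ?_ (abs_nonneg _) (by positivity)
      refine (abs_add_le _ _).trans ((add_le_add (hu1 j) (hl1 j)).trans (le_of_eq (by ring)))
    have : u j ^ 2 - l j ^ 2 = (u j - l j) * (u j + l j) := by ring
    linarith [neg_abs_le ((u j - l j) * (u j + l j))]
  rw [hprod]
  have key : ((P * A₁) ^ 3 * Real.exp (P * B) + P * (A₁ ^ 3 * Real.exp B)
    + (P * A₂) * (2 * P * A₁) / 2 + P * (A₂ * (2 * A₁)) / 2) * s ^ 3 =
    (P * (A₁ * s)) ^ 3 * Real.exp (P * B) + P * ((A₁ * s) ^ 3 * Real.exp B)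
    + (P * (A₂ * s ^ 2)) * (2 * P * A₁ * s) / 2 + P * ((A₂ * s ^ 2) * (2 * A₁ * s)) / 2 := by
    ring
  rw [key]
  linarith

/-- A weighted geometric mean is bounded below by the arithmetic expansion, up to a quadratic
error. -/
lemma exists_one_add_sum_le_prod_rpow {ι : Type*} [Fintype ι] (p : ι → ℝ) (hp : ∀ j, 0 ≤ p j)
    {c A : ℝ} (hc : 0 < c) :
    ∃ K, 0 ≤ K ∧ ∀ (h : ℝ) (r : ι → ℝ), 0 ≤ h → (∀ j, c ≤ r j) →
      (∀ j, |r j - 1| ≤ A * h) →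
      1 + ∑ j, p j * (r j - 1) ≤ ∏ j, r j ^ p j + K * h ^ 2 := by
  refine ⟨(∑ j, p j) * (A ^ 2 / c), mul_nonneg (Finset.sum_nonneg fun j _ => hp j)
    (by positivity), ?_⟩
  intro h r hh hr h1
  have hr0 : ∀ j, 0 < r j := fun j => hc.trans_le (hr j)
  have hprod : ∏ j, r j ^ p j = Real.exp (∑ j, p j * Real.log (r j)) := by
    rw [Real.exp_sum]
    refine Finset.prod_congr rfl fun j _ => ?_
    rw [Real.rpow_def_of_pos (hr0 j), mul_comm]
  -- Termwise log r ≥ (r - 1) - (r - 1)²/c; then 1 + x ≤ exp x finishes.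
  have e : ∑ j, p j * (r j - 1) ≤ ∑ j, p j * Real.log (r j) + (∑ j, p j) * (A ^ 2 / c) * h ^ 2 := by
    rw [mul_assoc, Finset.sum_mul, ← Finset.sum_add_distrib]
    refine Finset.sum_le_sum fun j _ => ?_
    rw [← mul_add]
    refine mul_le_mul_of_nonneg_left ?_ (hp j)
    have e1 := (abs_le.1 (abs_log_sub_le hc (hr j))).1
    have e2 : (r j - 1) ^ 2 ≤ (A * h) ^ 2 := by
      rw [← sq_abs]; gcongr; exact h1 j
    have e3 : (r j - 1) ^ 2 / c ≤ A ^ 2 / c * h ^ 2 := by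
      rw [div_mul_eq_mul_div, ← mul_pow]; gcongr
    linarith
  have := Real.add_one_le_exp (∑ j, p j * Real.log (r j))
  rw [hprod]; linarith

end

section

open MeasureTheory ProbabilityTheory Filter Topology
open scoped ENNReal NNReal RealInnerProductSpace

/-! ### The heat semigroup and the functions it acts on. -/

section Heat

variable {H : Type*} [NormedAddCommGroup H] [InnerProductSpace ℝ H] [FiniteDimensional ℝ H]
  [MeasurableSpace H] [BorelSpace H]

lemma integral_inner_stdGaussian (α : H) : ∫ y, ⟪α, y⟫ ∂(stdGaussian H) = 0 :=
  integral_strongDual_stdGaussian (innerSL ℝ α)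

lemma integrable_inner_sq_stdGaussian (α : H) :
    Integrable (fun y => ⟪α, y⟫ ^ 2) (stdGaussian H) :=
  (IsGaussian.memLp_dual (stdGaussian H) (innerSL ℝ α) 2 (by norm_num)).integrable_sq

lemma integral_inner_sq_stdGaussian (α : H) : ∫ y, ⟪α, y⟫ ^ 2 ∂(stdGaussian H) = ‖α‖ ^ 2 := by
  have h := variance_dual_stdGaussian (innerSL ℝ α)
  rw [variance_of_integral_eq_zero (innerSL ℝ α).continuous.aemeasurable
    (integral_strongDual_stdGaussian (innerSL ℝ α)), innerSL_apply_norm] at h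
  exact h

lemma integrable_norm_pow_stdGaussian (k : ℕ) :
    Integrable (fun y : H => ‖y‖ ^ k) (stdGaussian H) := by
  rcases eq_or_ne k 0 with rfl | hk
  · simp
  · exact (IsGaussian.memLp_id (stdGaussian H) k (by simp)).integrable_norm_pow hk

/-- Variances of independent Gaussians add; this is the semigroup law behind `heat_heat`. -/
lemma stdGaussian_map_smul_conv {s t : ℝ} (hs : 0 ≤ s) (ht : 0 ≤ t) :
    ((stdGaussian H).map (√s • ·)) ∗ ((stdGaussian H).map (√t • ·))
      = (stdGaussian H).map (√(s + t) • ·) := by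
  have : ∀ r : ℝ, IsProbabilityMeasure ((stdGaussian H).map (r • ·)) := fun r =>
    Measure.isProbabilityMeasure_map (by fun_prop)
  apply Measure.ext_of_charFun
  ext x
  rw [charFun_conv, charFun_map_smul, charFun_map_smul, charFun_map_smul, charFun_stdGaussian,
    charFun_stdGaussian, charFun_stdGaussian, ← Complex.exp_add]
  congr 1
  simp only [norm_smul, Real.norm_eq_abs, mul_pow, Complex.ofReal_mul, ← Complex.ofReal_pow, sq_abs,
    Real.sq_sqrt hs, Real.sq_sqrt ht, Real.sq_sqrt (add_nonneg hs ht)]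
  push_cast
  ring

/-- The heat semigroup. -/
noncomputable def heat (t : ℝ) (F : H → ℝ) (x : H) : ℝ := ∫ y, F (x + √t • y) ∂(stdGaussian H)

lemma heat_heat {F : H → ℝ} (hF : Continuous F) {C : ℝ} (hC : ∀ x, |F x| ≤ C) {s t : ℝ}
    (hs : 0 ≤ s) (ht : 0 ≤ t) : heat s (heat t F) = heat (s + t) F := by
  have : ∀ r : ℝ, IsProbabilityMeasure ((stdGaussian H).map (r • ·)) := fun r =>
    Measure.isProbabilityMeasure_map (by fun_prop)
  ext x
  have hm : ∀ r : ℝ, AEMeasurable (fun y : H => r • y) (stdGaussian H) := fun r => by fun_prop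
  have h1 : heat (s + t) F x = ∫ z, F (x + z) ∂((stdGaussian H).map (√(s + t) • ·)) := by
    rw [integral_map (hm _) (by fun_prop)]; rfl
  have hint : Integrable (fun z => F (x + z))
      (((stdGaussian H).map (√s • ·)) ∗ ((stdGaussian H).map (√t • ·))) :=
    Integrable.of_bound (by fun_prop) C (Eventually.of_forall fun z => hC _)
  rw [h1, ← stdGaussian_map_smul_conv hs ht, integral_conv hint]
  have h2 : ∀ y, ∫ z, F (x + (y + z)) ∂((stdGaussian H).map (√t • ·)) = heat t F (x + y) := by
    intro y
    rw [integral_map (hm _) (by fun_prop)]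
    simp only [heat, add_assoc]
  simp only [h2]
  have h3 : Continuous (heat t F) := by
    refine continuous_of_dominated (bound := fun _ => C) (fun x => by fun_prop)
      (fun x => Eventually.of_forall fun y => hC _) (integrable_const _)
      (Eventually.of_forall fun y => by fun_prop)
  rw [integral_map (hm _) (by fun_prop)]
  rfl

lemma heat_zero (F : H → ℝ) : heat 0 F = F := by
  ext x; simp [heat]

lemma heat_one_zero (F : H → ℝ) : heat 1 F 0 = ∫ y, F y ∂(stdGaussian H) := by
  simp [heat]

variable {E : Type*} [NormedAddCommGroup E] [InnerProductSpace ℝ E] [FiniteDimensional ℝ E]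

/-- Positive bounded functions with bounded gradient in the range of the adjoint of `M` and with
uniformly quadratic first-order Taylor remainder. -/
structure HeatRegular (M : H →L[ℝ] E) (a b K : ℝ) (F : H → ℝ) : Prop where
  lower : ∀ x, a ≤ F x
  upper : ∀ x, F x ≤ b
  lipschitz : ∀ x y, |F (x + y) - F x| ≤ K * ‖y‖
  taylor : ∃ w : H → E, Continuous w ∧ (∀ x, ‖w x‖ ≤ K) ∧
    ∀ x y, |F (x + y) - F x - ⟪w x, M y⟫| ≤ K * ‖y‖ ^ 2

namespace HeatRegular

variable {M : H →L[ℝ] E} {a b K : ℝ} {F : H → ℝ}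

lemma nonneg_const (hF : HeatRegular M a b K F) : 0 ≤ K := by
  obtain ⟨w, -, hw, -⟩ := hF.taylor
  exact (norm_nonneg _).trans (hw 0)

lemma continuous (hF : HeatRegular M a b K F) : Continuous F := by
  have : LipschitzWith K.toNNReal F := by
    refine LipschitzWith.of_dist_le_mul fun x y => ?_
    rw [Real.dist_eq, dist_eq_norm, Real.coe_toNNReal _ hF.nonneg_const]
    simpa using hF.lipschitz y (x - y)
  exact this.continuous

lemma abs_le (hF : HeatRegular M a b K F) (x : H) : |F x| ≤ max |a| |b| :=
  abs_le_max_abs_abs (hF.lower x) (hF.upper x)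

lemma integrable (hF : HeatRegular M a b K F) (x : H) (r : ℝ) :
    Integrable (fun y => F (x + r • y)) (stdGaussian H) := by
  have := hF.continuous
  exact Integrable.of_bound (by fun_prop) _ (Eventually.of_forall fun y => hF.abs_le _)

/-- Each defining condition is a translation-invariant inequality and survives averaging, with `w`
averaged too. The constants a, b, K do not change, so the error constant of one heat step can be
reused at every step. -/
lemma heat (hF : HeatRegular M a b K F) (t : ℝ) : HeatRegular M a b K (heat t F) := by
  have hK := hF.nonneg_const
  have bound : ∀ {g : H → ℝ} {D : ℝ}, (∀ y, |g y| ≤ D) → |∫ y, g y ∂(stdGaussian H)| ≤ D := by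
    intro g D hg
    have := norm_integral_le_of_norm_le_const (μ := stdGaussian H) (f := g) (C := D)
      (Eventually.of_forall hg)
    simpa using this
  refine ⟨fun x => ?_, fun x => ?_, fun x y => ?_, ?_⟩
  · have := integral_mono (integrable_const a) (hF.integrable x (√t)) fun y => hF.lower _
    simpa [BrascampLieb.heat] using this
  · have := integral_mono (hF.integrable x (√t)) (integrable_const b) fun y => hF.upper _
    simpa [BrascampLieb.heat] using this
  · rw [BrascampLieb.heat, BrascampLieb.heat,
      ← integral_sub (hF.integrable _ _) (hF.integrable _ _)]
    refine bound fun z => ?_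
    have := hF.lipschitz (x + √t • z) y
    rwa [add_right_comm] at this
  · obtain ⟨w, hwc, hwK, hw⟩ := hF.taylor
    have hint : ∀ x, Integrable (fun y => w (x + √t • y)) (stdGaussian H) := fun x =>
      Integrable.of_bound (by fun_prop) K (Eventually.of_forall fun y => hwK _)
    refine ⟨fun x => ∫ y, w (x + √t • y) ∂(stdGaussian H), ?_, fun x => ?_, fun x y => ?_⟩
    · exact continuous_of_dominated (bound := fun _ => K) (fun x => (hint x).1)
        (fun x => Eventually.of_forall fun y => hwK _) (integrable_const _)
        (Eventually.of_forall fun y => by fun_prop)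
    · have := norm_integral_le_of_norm_le_const (μ := stdGaussian H)
        (f := fun y => w (x + √t • y)) (C := K) (Eventually.of_forall fun y => hwK _)
      simpa using this
    · have e : ⟪∫ z, w (x + √t • z) ∂(stdGaussian H), M y⟫
          = ∫ z, ⟪w (x + √t • z), M y⟫ ∂(stdGaussian H) := by
        rw [real_inner_comm, ← integral_inner (hint x)]
        simp only [real_inner_comm]
      have hi : Integrable (fun z => ⟪w (x + √t • z), M y⟫) (stdGaussian H) :=
        (hint x).inner_const _
      rw [BrascampLieb.heat, BrascampLieb.heat, e,
        ← integral_sub (hF.integrable _ _) (hF.integrable _ _),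
        ← integral_sub (f := fun z => F (x + y + √t • z) - F (x + √t • z))
          ((hF.integrable _ _).sub (hF.integrable _ _)) hi]
      refine bound fun z => ?_
      have := hw (x + √t • z) y
      rwa [add_right_comm] at this

end HeatRegular

end Heat

end

section

open MeasureTheory ProbabilityTheory Filter Topology
open scoped ENNReal NNReal RealInnerProductSpace

/-! ### Heat flow proof of the inequality for the standard Gaussian measure. -/

section GaussianInequality

variable {ι : Type*} [Fintype ι]
  {H : Type*} [NormedAddCommGroup H] [InnerProductSpace ℝ H] [FiniteDimensional ℝ H]
  [MeasurableSpace H] [BorelSpace H]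
  {E : ι → Type*} [∀ j, NormedAddCommGroup (E j)] [∀ j, InnerProductSpace ℝ (E j)]
  [∀ j, FiniteDimensional ℝ (E j)]

lemma continuous_prod_rpow {p : ι → ℝ} (hp : ∀ j, 0 ≤ p j) {F : ι → H → ℝ}
    (hF : ∀ j, Continuous (F j)) : Continuous fun x => ∏ j, F j x ^ p j :=
  continuous_finsetProd _ fun j _ => (hF j).rpow_const fun _ => Or.inr (hp j)

lemma abs_prod_rpow_le {p : ι → ℝ} (hp : ∀ j, 0 ≤ p j) {b : ℝ} {r : ι → ℝ}
    (hr : ∀ j, 0 ≤ r j) (hb : ∀ j, r j ≤ b) : |∏ j, r j ^ p j| ≤ ∏ j, b ^ p j := by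
  rw [abs_of_nonneg (Finset.prod_nonneg fun j _ => Real.rpow_nonneg (hr j) _)]
  exact Finset.prod_le_prod (fun j _ => Real.rpow_nonneg (hr j) _)
    fun j _ => Real.rpow_le_rpow (hr j) (hb j) (hp j)

/-- One small step of the heat flow almost preserves the ordering between the heat flow of a
geometric mean and the geometric mean of the heat flows. -/
lemma exists_heat_step {p : ι → ℝ} (hp : ∀ j, 0 ≤ p j) (M : ∀ j, H →L[ℝ] E j)
    (hM : ∀ w : ∀ j, E j, ‖∑ j, p j • (M j).adjoint (w j)‖ ^ 2
      ≤ ∑ j, p j * ‖(M j).adjoint (w j)‖ ^ 2) {a b K : ℝ} (ha : 0 < a) (hab : a ≤ b)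
    (hK : 0 ≤ K) :
    ∃ κ, 0 ≤ κ ∧ ∀ h : ℝ, 0 ≤ h → h ≤ 1 → ∀ F : ι → H → ℝ,
      (∀ j, HeatRegular (M j) a b K (F j)) → ∀ x,
      heat h (fun x => ∏ j, F j x ^ p j) x ≤ (1 + κ * √h ^ 3) * ∏ j, heat h (F j) x ^ p j := by
  have hb : 0 < b := ha.trans_le hab
  set c := a / b with hc
  have hc0 : 0 < c := by positivity
  have hc1 : c ≤ 1 := (div_le_one hb).2 hab
  -- One constant serving both for the relative increments (K / a) and for their linear parts (K ‖M
  -- j‖ / a).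
  set A := K * (1 + ∑ j, ‖M j‖) / a with hA
  have hsum : 0 ≤ ∑ j, ‖M j‖ := Finset.sum_nonneg fun j _ => norm_nonneg _
  have hA0 : 0 ≤ A := by positivity
  have hKA : K / a ≤ A := by
    rw [hA]; gcongr
    exact le_mul_of_one_le_right hK (by linarith)
  obtain ⟨K₁, hK₁, step1⟩ := exists_prod_rpow_le_quadratic p hp hc0 hc1 hA0
  set m₂ := ∫ y : H, ‖y‖ ^ 2 ∂(stdGaussian H)
  set m₃ := ∫ y : H, ‖y‖ ^ 3 ∂(stdGaussian H)
  have hm₂ : 0 ≤ m₂ := integral_nonneg fun y => by positivity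
  have hm₃ : 0 ≤ m₃ := integral_nonneg fun y => by positivity
  obtain ⟨K₂, hK₂, step2⟩ := exists_one_add_sum_le_prod_rpow p hp (c := c) (A := A * m₂) hc0
  set q := ∏ j, c ^ p j with hq
  have hq0 : 0 < q := Finset.prod_pos fun j _ => Real.rpow_pos_of_pos hc0 _
  refine ⟨(K₁ * m₃ + K₂) / q, by positivity, ?_⟩
  intro h hh hh1 F hF x
  set σ := √h with hσ
  have hσ0 : 0 ≤ σ := Real.sqrt_nonneg _
  have hσ1 : σ ≤ 1 := Real.sqrt_le_one.2 hh1
  have hσh : σ ^ 2 = h := Real.sq_sqrt hh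
  have hFpos : ∀ j x, 0 < F j x := fun j x => ha.trans_le ((hF j).lower x)
  choose w hwc hwK hw using fun j => (hF j).taylor
  -- Dividing by the value at `x` reduces to increments around 1; `α j` is the gradient of log `F j`
  -- at `x`, which lies in the range of the adjoint of `M j`.
  set r : ι → H → ℝ := fun j y => F j (x + σ • y) / F j x with hr
  set α : ι → H := fun j => (M j).adjoint ((F j x)⁻¹ • w j x) with hα
  have hrl : ∀ j y, c ≤ r j y := fun j y =>
    div_le_div₀ (hFpos j _).le ((hF j).lower _) (hFpos j x) ((hF j).upper _)
  have hru : ∀ j y, r j y ≤ c⁻¹ := fun j y => by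
    rw [hc, inv_div]; exact div_le_div₀ hb.le ((hF j).upper _) ha ((hF j).lower _)
  have hinner : ∀ j y, ⟪α j, y⟫ = ⟪w j x, M j y⟫ / F j x := fun j y => by
    rw [hα, ContinuousLinearMap.adjoint_inner_left, real_inner_smul_left]; ring
  have hdiv : ∀ j (z D : ℝ), |z| ≤ D → |z / F j x| ≤ D / a := fun j z D hz => by
    rw [abs_div, abs_of_pos (hFpos j x)]
    exact div_le_div₀ ((abs_nonneg z).trans hz) hz ha ((hF j).lower x)
  have hr1 : ∀ j y, |r j y - 1| ≤ A * (σ * ‖y‖) := fun j y => by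
    have e : r j y - 1 = (F j (x + σ • y) - F j x) / F j x := by
      rw [hr, sub_div, div_self (hFpos j x).ne']
    rw [e]
    refine (hdiv j _ _ ((hF j).lipschitz x (σ • y))).trans ?_
    rw [norm_smul, Real.norm_of_nonneg hσ0, mul_div_right_comm]
    gcongr
  have hl1 : ∀ j y, |σ * ⟪α j, y⟫| ≤ A * (σ * ‖y‖) := fun j y => by
    have e1 : |⟪w j x, M j y⟫| ≤ K * (1 + ∑ j, ‖M j‖) * ‖y‖ := by
      have e3 : ‖M j‖ ≤ 1 + ∑ j, ‖M j‖ := by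
        have := Finset.single_le_sum (f := fun j => ‖M j‖) (fun j _ => norm_nonneg _)
          (Finset.mem_univ j)
        linarith
      calc |⟪w j x, M j y⟫| ≤ ‖w j x‖ * ‖M j y‖ := abs_real_inner_le_norm _ _
        _ ≤ K * (‖M j‖ * ‖y‖) := by
            gcongr
            · exact hwK j x
            · exact (M j).le_opNorm y
        _ ≤ K * ((1 + ∑ j, ‖M j‖) * ‖y‖) := by gcongr
        _ = _ := by ring
    have e2 := hdiv j _ _ e1
    rw [← hinner] at e2
    rw [abs_mul, abs_of_nonneg hσ0]
    calc σ * |⟪α j, y⟫| ≤ σ * (K * (1 + ∑ j, ‖M j‖) * ‖y‖ / a) := by gcongr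
      _ = _ := by rw [hA]; ring
  have hrl2 : ∀ j y, |r j y - 1 - σ * ⟪α j, y⟫| ≤ A * (σ * ‖y‖) ^ 2 := fun j y => by
    have e : r j y - 1 - σ * ⟪α j, y⟫
        = (F j (x + σ • y) - F j x - ⟪w j x, M j (σ • y)⟫) / F j x := by
      rw [hinner, map_smul, real_inner_smul_right, hr]
      have := (hFpos j x).ne'
      field_simp
    rw [e]
    refine (hdiv j _ _ (hw j x (σ • y))).trans ?_
    rw [norm_smul, Real.norm_of_nonneg hσ0, mul_div_right_comm]
    gcongr
  have hrint : ∀ j, Integrable (r j) (stdGaussian H) := fun j =>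
    ((hF j).integrable x σ).div_const _
  have hrmean : ∀ j, ∫ y, r j y ∂(stdGaussian H) = heat h (F j) x / F j x := fun j => by
    rw [hr, integral_div]; rfl
  set ρ : ι → ℝ := fun j => ∫ y, r j y ∂(stdGaussian H) with hρ
  have hρl : ∀ j, c ≤ ρ j := fun j => by
    have := integral_mono (integrable_const c) (hrint j) fun y => hrl j y
    simpa using this
  -- The linear part has Gaussian mean zero, so the averaged increment is O(h) and not merely O(√h).
  have hρ1 : ∀ j, |ρ j - 1| ≤ A * m₂ * h := fun j => by
    have i1 : Integrable (fun y => r j y - 1) (stdGaussian H) := (hrint j).sub (integrable_const 1)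
    have i2 : Integrable (fun y => σ * ⟪α j, y⟫) (stdGaussian H) :=
      ((IsGaussian.memLp_dual (stdGaussian H) (innerSL ℝ (α j)) 1 (by norm_num)).integrable
        le_rfl).const_mul σ
    have e : ρ j - 1 = ∫ y, (r j y - 1 - σ * ⟪α j, y⟫) ∂(stdGaussian H) := by
      rw [integral_sub i1 i2, integral_const_mul, integral_inner_stdGaussian,
        integral_sub (hrint j) (integrable_const 1)]
      simp [hρ]
    rw [e]
    refine (abs_integral_le_integral_abs).trans ?_
    have : A * m₂ * h = ∫ y : H, A * (σ * ‖y‖) ^ 2 ∂(stdGaussian H) := by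
      simp only [mul_pow, hσh]
      rw [integral_const_mul, integral_const_mul]; ring
    rw [this]
    refine integral_mono (i1.sub i2).abs ?_ fun y => hrl2 j y
    simp only [mul_pow]
    exact ((integrable_norm_pow_stdGaussian 2).const_mul _).const_mul _
  -- The Gaussian mean of ⟪α, y⟫² is ‖α‖², so the averaged quadratic term is h times the difference
  -- in `hM`, hence nonpositive.
  have hQ : ∫ y, ((∑ j, p j * (σ * ⟪α j, y⟫)) ^ 2 - ∑ j, p j * (σ * ⟪α j, y⟫) ^ 2)
      ∂(stdGaussian H) ≤ 0 := by
    have e : ∀ y, (∑ j, p j * (σ * ⟪α j, y⟫)) ^ 2 - ∑ j, p j * (σ * ⟪α j, y⟫) ^ 2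
        = σ ^ 2 * (⟪∑ j, p j • α j, y⟫ ^ 2 - ∑ j, p j * ⟪α j, y⟫ ^ 2) := by
      intro y
      rw [sum_inner, mul_sub, ← mul_pow, Finset.mul_sum, Finset.mul_sum]
      simp only [real_inner_smul_left]
      congr 2
      · exact Finset.sum_congr rfl fun j _ => by ring
      · ext j; ring
    simp only [e]
    rw [integral_const_mul, integral_sub (integrable_inner_sq_stdGaussian _)
      (integrable_finsetSum _ fun j _ => (integrable_inner_sq_stdGaussian _).const_mul _),
      integral_finsetSum _ fun j _ => (integrable_inner_sq_stdGaussian _).const_mul _]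
    simp only [integral_const_mul, integral_inner_sq_stdGaussian]
    have := hM fun j => (F j x)⁻¹ • w j x
    exact mul_nonpos_of_nonneg_of_nonpos (by positivity) (by simpa [hα] using this)
  have hQint : Integrable (fun y => (∑ j, p j * (σ * ⟪α j, y⟫)) ^ 2
      - ∑ j, p j * (σ * ⟪α j, y⟫) ^ 2) (stdGaussian H) := by
    have e : (fun y => (∑ j, p j * (σ * ⟪α j, y⟫)) ^ 2)
        = fun y => ⟪∑ j, (p j * σ) • α j, y⟫ ^ 2 := by
      ext y
      rw [sum_inner]
      simp only [real_inner_smul_left, mul_assoc]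
    refine Integrable.sub ?_ (integrable_finsetSum _ fun j _ => ?_)
    · rw [e]; exact integrable_inner_sq_stdGaussian _
    · simp only [mul_pow]
      exact ((integrable_inner_sq_stdGaussian _).const_mul _).const_mul _
  have hFc : ∀ j, Continuous (F j) := fun j => (hF j).continuous
  have hprodint : Integrable (fun y => ∏ j, r j y ^ p j) (stdGaussian H) := by
    refine Integrable.of_bound (Continuous.aestronglyMeasurable ?_) (∏ j, (c⁻¹) ^ p j)
      (Eventually.of_forall fun y => abs_prod_rpow_le hp (fun j => hc0.le.trans (hrl j y))
        fun j => hru j y)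
    exact continuous_prod_rpow hp fun j => by have := hFc j; fun_prop
  have main : ∫ y, ∏ j, r j y ^ p j ∂(stdGaussian H)
      ≤ 1 + ∑ j, p j * (ρ j - 1) + K₁ * m₃ * σ ^ 3 := by
    have i1 : ∀ j, Integrable (fun y => p j * (r j y - 1)) (stdGaussian H) := fun j =>
      ((hrint j).sub (integrable_const 1)).const_mul _
    have i2 := integrable_finsetSum Finset.univ fun j (_ : j ∈ Finset.univ) => i1 j
    have i3 : Integrable (fun y : H => K₁ * (σ * ‖y‖) ^ 3) (stdGaussian H) := by
      simp only [mul_pow]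
      exact ((integrable_norm_pow_stdGaussian 3).const_mul _).const_mul _
    have h1 : _ ≤ ∫ y, (1 + ∑ j, p j * (r j y - 1) + ((∑ j, p j * (σ * ⟪α j, y⟫)) ^ 2
        - ∑ j, p j * (σ * ⟪α j, y⟫) ^ 2) / 2 + K₁ * (σ * ‖y‖) ^ 3) ∂(stdGaussian H) :=
      integral_mono hprodint ((((integrable_const (1 : ℝ)).add i2).add
      (hQint.div_const 2)).add i3) fun y =>
      step1 (σ * ‖y‖) (fun j => r j y) (fun j => σ * ⟪α j, y⟫) (by positivity)
        (fun j => hrl j y) (fun j => hru j y) (fun j => hr1 j y) (fun j => hl1 j y)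
        (fun j => hrl2 j y)
    refine h1.trans ?_
    have i4 : Integrable (fun y => 1 + ∑ j, p j * (r j y - 1)) (stdGaussian H) :=
      (integrable_const (1 : ℝ)).add i2
    have i5 : Integrable (fun y => 1 + ∑ j, p j * (r j y - 1) + ((∑ j, p j * (σ * ⟪α j, y⟫)) ^ 2
        - ∑ j, p j * (σ * ⟪α j, y⟫) ^ 2) / 2) (stdGaussian H) := i4.add (hQint.div_const 2)
    rw [integral_add i5 i3, integral_add i4 (hQint.div_const 2),
      integral_add (integrable_const (1 : ℝ)) i2, integral_div,
      integral_finsetSum _ fun j _ => i1 j]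
    have e1 : ∀ j, ∫ y, p j * (r j y - 1) ∂(stdGaussian H) = p j * (ρ j - 1) := fun j => by
      rw [integral_const_mul, integral_sub (hrint j) (integrable_const 1)]; simp [hρ]
    have e2 : ∫ y : H, K₁ * (σ * ‖y‖) ^ 3 ∂(stdGaussian H) = K₁ * m₃ * σ ^ 3 := by
      simp only [mul_pow]
      rw [integral_const_mul, integral_const_mul]; ring
    simp only [e1, e2]
    have e3 : ∫ _ : H, (1 : ℝ) ∂(stdGaussian H) = 1 := by simp
    rw [e3]
    linarith
  have hρprod : q ≤ ∏ j, ρ j ^ p j := Finset.prod_le_prod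
    (fun j _ => (Real.rpow_pos_of_pos hc0 _).le)
    fun j _ => Real.rpow_le_rpow hc0.le (hρl j) (hp j)
  have key : ∫ y, ∏ j, r j y ^ p j ∂(stdGaussian H)
      ≤ (1 + (K₁ * m₃ + K₂) / q * σ ^ 3) * ∏ j, ρ j ^ p j := by
    have e1 := step2 h ρ hh hρl hρ1
    have e2 : K₂ * h ^ 2 ≤ K₂ * σ ^ 3 := by
      rw [← hσh, ← pow_mul]
      exact mul_le_mul_of_nonneg_left (pow_le_pow_of_le_one hσ0 hσ1 (by norm_num)) hK₂
    -- The lower bound `q` on the product of means converts the additive error into a relative one.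
    have e3 : (K₁ * m₃ + K₂) * σ ^ 3 ≤ (K₁ * m₃ + K₂) / q * σ ^ 3 * ∏ j, ρ j ^ p j := by
      calc (K₁ * m₃ + K₂) * σ ^ 3 = (K₁ * m₃ + K₂) / q * σ ^ 3 * q := by field_simp
        _ ≤ _ := by gcongr
    linarith
  set G := ∏ j, F j x ^ p j with hG
  have hG0 : 0 < G := Finset.prod_pos fun j _ => Real.rpow_pos_of_pos (hFpos j x) _
  have e1 : heat h (fun x => ∏ j, F j x ^ p j) x
      = G * ∫ y, ∏ j, r j y ^ p j ∂(stdGaussian H) := by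
    rw [← integral_const_mul]
    refine integral_congr_ae (Eventually.of_forall fun y => ?_)
    simp only [hG, ← Finset.prod_mul_distrib]
    refine Finset.prod_congr rfl fun j _ => ?_
    rw [← Real.mul_rpow (hFpos j x).le (hc0.le.trans (hrl j y)), hr,
      mul_div_cancel₀ _ (hFpos j x).ne']
  have e2 : ∏ j, heat h (F j) x ^ p j = G * ∏ j, ρ j ^ p j := by
    simp only [hG, ← Finset.prod_mul_distrib]
    refine Finset.prod_congr rfl fun j _ => ?_
    rw [← Real.mul_rpow (hFpos j x).le (hc0.le.trans (hρl j)),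
      show ρ j = heat h (F j) x / F j x from hrmean j,
      mul_div_cancel₀ _ (hFpos j x).ne']
  rw [e1, e2, mul_left_comm]
  exact mul_le_mul_of_nonneg_left key hG0.le

/-- The Brascamp-Lieb inequality for the standard Gaussian measure, for regular functions. -/
theorem integral_prod_rpow_le_of_heatRegular {p : ι → ℝ} (hp : ∀ j, 0 ≤ p j)
    (M : ∀ j, H →L[ℝ] E j)
    (hM : ∀ w : ∀ j, E j, ‖∑ j, p j • (M j).adjoint (w j)‖ ^ 2
      ≤ ∑ j, p j * ‖(M j).adjoint (w j)‖ ^ 2) {a b K : ℝ} (ha : 0 < a) (hab : a ≤ b)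
    (hK : 0 ≤ K) {F : ι → H → ℝ} (hF : ∀ j, HeatRegular (M j) a b K (F j)) :
    ∫ x, ∏ j, F j x ^ p j ∂(stdGaussian H) ≤ ∏ j, (∫ x, F j x ∂(stdGaussian H)) ^ p j := by
  obtain ⟨κ, hκ, step⟩ := exists_heat_step hp M hM ha hab hK
  have hpos : ∀ {F : ι → H → ℝ}, (∀ j, HeatRegular (M j) a b K (F j)) → ∀ j x, 0 ≤ F j x :=
    fun hF j x => ha.le.trans ((hF j).lower x)
  have hcont : ∀ {F : ι → H → ℝ}, (∀ j, HeatRegular (M j) a b K (F j)) →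
      Continuous fun x => ∏ j, F j x ^ p j :=
    fun hF => continuous_prod_rpow hp fun j => (hF j).continuous
  have hbdd : ∀ {F : ι → H → ℝ}, (∀ j, HeatRegular (M j) a b K (F j)) →
      ∀ x, |∏ j, F j x ^ p j| ≤ ∏ j, b ^ p j :=
    fun hF x => abs_prod_rpow_le hp (fun j => hpos hF j x) fun j => (hF j).upper x
  have hint : ∀ {F : ι → H → ℝ}, (∀ j, HeatRegular (M j) a b K (F j)) → ∀ x (s : ℝ),
      Integrable (fun y => ∏ j, F j (x + s • y) ^ p j) (stdGaussian H) := fun hF x s => by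
    have := hcont hF
    exact Integrable.of_bound (this.comp (by fun_prop)).aestronglyMeasurable _
      (Eventually.of_forall fun y => hbdd hF _)
  -- In the inductive step one short step is applied to `F`, and the induction hypothesis to the
  -- functions `heat h (F j)`, which are regular with the same constants.
  have iter : ∀ (h : ℝ), 0 ≤ h → h ≤ 1 → ∀ (k : ℕ) (F : ι → H → ℝ),
      (∀ j, HeatRegular (M j) a b K (F j)) → ∀ x,
      heat (k * h) (fun x => ∏ j, F j x ^ p j) x
        ≤ (1 + κ * √h ^ 3) ^ k * ∏ j, heat (k * h) (F j) x ^ p j := by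
    intro h hh hh1 k
    induction k with
    | zero => intro F hF x; simp [heat_zero]
    | succ k ih =>
      intro F hF x
      have hF' : ∀ j, HeatRegular (M j) a b K (heat h (F j)) := fun j => (hF j).heat h
      have hkh : (0 : ℝ) ≤ k * h := by positivity
      have e1 : ((k + 1 : ℕ) : ℝ) * h = k * h + h := by push_cast; ring
      have e2 : ∀ j, heat (k * h + h) (F j) = heat (k * h) (heat h (F j)) := fun j =>
        (heat_heat (hF j).continuous (hF j).abs_le hkh hh).symm
      rw [e1, ← heat_heat (hcont hF) (hbdd hF) hkh hh]
      simp only [e2]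
      have hmono : heat (k * h) (heat h fun x => ∏ j, F j x ^ p j) x
          ≤ (1 + κ * √h ^ 3) * heat (k * h) (fun x => ∏ j, heat h (F j) x ^ p j) x := by
        rw [heat, heat, ← integral_const_mul]
        refine integral_mono_of_nonneg (Eventually.of_forall fun y => ?_)
          ((hint hF' x _).const_mul _) (Eventually.of_forall fun y => step h hh hh1 F hF _)
        exact integral_nonneg fun z =>
          Finset.prod_nonneg fun j _ => Real.rpow_nonneg (hpos hF j _) _
      refine hmono.trans ?_
      rw [pow_succ' (1 + κ * √h ^ 3), mul_assoc]
      exact mul_le_mul_of_nonneg_left (ih _ hF' x) (by positivity)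
  -- N steps of length 1/N accumulate (1 + κ N^{-3/2})^N ≤ exp(κ/√N), which tends to 1.
  have lim : ∀ N : ℕ, 0 < N → ∫ x, ∏ j, F j x ^ p j ∂(stdGaussian H)
      ≤ Real.exp (κ / √N) * ∏ j, (∫ x, F j x ∂(stdGaussian H)) ^ p j := by
    intro N hN
    have hN0 : (0 : ℝ) < N := by exact_mod_cast hN
    have hN1 : (1 : ℝ) ≤ N := by exact_mod_cast hN
    have h1 := iter (1 / N) (by positivity) ((div_le_one hN0).2 hN1) N F hF 0
    have e1 : (N : ℝ) * (1 / N) = 1 := by field_simp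
    simp only [e1, heat_one_zero] at h1
    refine h1.trans (mul_le_mul_of_nonneg_right ?_ (Finset.prod_nonneg fun j _ =>
      Real.rpow_nonneg (integral_nonneg fun x => hpos hF j x) _))
    have e2 : (1 + κ * √(1 / (N : ℝ)) ^ 3) ≤ Real.exp (κ * √(1 / (N : ℝ)) ^ 3) := by
      rw [add_comm]; exact Real.add_one_le_exp _
    refine (pow_le_pow_left₀ (by positivity) e2 N).trans (le_of_eq ?_)
    rw [← Real.exp_nat_mul]
    congr 1
    have : √(N : ℝ) ^ 2 = N := Real.sq_sqrt hN0.le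
    have h0 : √(N : ℝ) ≠ 0 := (Real.sqrt_pos.2 hN0).ne'
    rw [Real.sqrt_div zero_le_one, Real.sqrt_one, ← this]
    have e3 : √(√(N : ℝ) ^ 2) = √(N : ℝ) := Real.sqrt_sq (Real.sqrt_nonneg _)
    rw [e3]
    field_simp
  have ht : Tendsto (fun N : ℕ => Real.exp (κ / √N)
      * ∏ j, (∫ x, F j x ∂(stdGaussian H)) ^ p j) atTop
      (𝓝 (Real.exp 0 * ∏ j, (∫ x, F j x ∂(stdGaussian H)) ^ p j)) := by
    refine Tendsto.mul_const _ ((Real.continuous_exp.tendsto 0).comp ?_)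
    exact Tendsto.const_div_atTop (Real.tendsto_sqrt_atTop.comp tendsto_natCast_atTop_atTop) κ
  rw [Real.exp_zero, one_mul] at ht
  exact ge_of_tendsto ht (eventually_atTop.2 ⟨1, fun N hN => lim N hN⟩)

end GaussianInequality

end

section

open MeasureTheory ProbabilityTheory Filter Topology
open scoped ENNReal NNReal RealInnerProductSpace

/-! ### Comparison of the standard Gaussian measure with Lebesgue measure. -/

section Density

variable {H : Type*} [NormedAddCommGroup H] [InnerProductSpace ℝ H] [FiniteDimensional ℝ H]
  [MeasurableSpace H] [BorelSpace H]
  {E : Type*} [NormedAddCommGroup E] [InnerProductSpace ℝ E] [FiniteDimensional ℝ E]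
  [MeasurableSpace E] [BorelSpace E]

variable (H) in
/-- The density of the standard Gaussian measure at the origin. -/
noncomputable def gaussianPeak : ℝ := ((2 * Real.pi) ^ (Module.finrank ℝ H / 2 : ℝ))⁻¹

lemma gaussianPeak_pos : 0 < gaussianPeak H := by
  unfold gaussianPeak; positivity

lemma integrable_gaussian_density :
    Integrable (fun x : H => gaussianPeak H * Real.exp (-‖x‖ ^ 2 / 2)) := by
  refine Integrable.const_mul ?_ _
  have h := GaussianFourier.integrable_cexp_neg_mul_sq_norm_add (V := H) (b := 1 / 2)
    (by norm_num) 0 0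
  have h2 := h.norm
  refine h2.congr (Eventually.of_forall fun x => ?_)
  simp only [zero_mul, add_zero, Complex.norm_exp]
  congr 1
  have : (-(1 / 2 : ℂ) * (‖x‖ : ℂ) ^ 2) = ((-‖x‖ ^ 2 / 2 : ℝ) : ℂ) := by push_cast; ring
  rw [this, Complex.ofReal_re]

lemma stdGaussian_eq_withDensity :
    stdGaussian H = volume.withDensity
      fun x => ENNReal.ofReal (gaussianPeak H * Real.exp (-‖x‖ ^ 2 / 2)) := by
  have hfin : IsFiniteMeasure ((volume : Measure H).withDensity
      fun x => ENNReal.ofReal (gaussianPeak H * Real.exp (-‖x‖ ^ 2 / 2))) := by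
    refine isFiniteMeasure_withDensity ?_
    have := (integrable_gaussian_density (H := H)).lintegral_lt_top
    exact this.ne
  apply Measure.ext_of_charFun
  ext t
  rw [charFun_stdGaussian, charFun_apply]
  have e1 : ∀ x : H, 0 ≤ gaussianPeak H * Real.exp (-‖x‖ ^ 2 / 2) := fun x =>
    mul_nonneg gaussianPeak_pos.le (Real.exp_pos _).le
  rw [integral_withDensity_eq_integral_toReal_smul (by fun_prop)
    (Eventually.of_forall fun x => ENNReal.ofReal_lt_top)]
  have e2 : ∀ x : H, (ENNReal.ofReal (gaussianPeak H * Real.exp (-‖x‖ ^ 2 / 2))).toReal •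
      Complex.exp (⟪x, t⟫ * Complex.I)
      = (gaussianPeak H : ℂ) * Complex.exp (-(1 / 2 : ℂ) * (‖x‖ : ℂ) ^ 2
        + Complex.I * ⟪t, x⟫) := by
    intro x
    rw [ENNReal.toReal_ofReal (e1 x), Complex.real_smul, Complex.ofReal_mul, Complex.ofReal_exp,
      mul_assoc, ← Complex.exp_add, real_inner_comm]
    congr 2
    push_cast
    ring
  simp only [e2]
  rw [integral_const_mul, GaussianFourier.integral_cexp_neg_mul_sq_norm_add (by norm_num)]
  have e3 : ((Real.pi : ℂ) / (1 / 2)) ^ (Module.finrank ℝ H / 2 : ℂ)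
      = ((gaussianPeak H)⁻¹ : ℝ) := by
    rw [gaussianPeak, inv_inv, Complex.ofReal_cpow (by positivity)]
    push_cast
    congr 1
    ring
  rw [e3, ← mul_assoc, ← Complex.ofReal_mul, mul_inv_cancel₀ gaussianPeak_pos.ne',
    Complex.ofReal_one, one_mul]
  congr 1
  rw [Complex.I_sq]
  ring

lemma lintegral_stdGaussian {g : H → ℝ≥0∞} (hg : Measurable g) :
    ∫⁻ x, g x ∂(stdGaussian H)
      = ∫⁻ x, ENNReal.ofReal (gaussianPeak H * Real.exp (-‖x‖ ^ 2 / 2)) * g x := by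
  rw [stdGaussian_eq_withDensity, lintegral_withDensity_eq_lintegral_mul _ (by fun_prop) hg]
  rfl

lemma lintegral_stdGaussian_le {g : H → ℝ≥0∞} (hg : Measurable g) :
    ∫⁻ x, g x ∂(stdGaussian H) ≤ ENNReal.ofReal (gaussianPeak H) * ∫⁻ x, g x := by
  rw [lintegral_stdGaussian hg, ← lintegral_const_mul _ hg]
  refine lintegral_mono fun x => ?_
  gcongr
  refine mul_le_of_le_one_right gaussianPeak_pos.le (Real.exp_le_one_iff.2 ?_)
  have : 0 ≤ ‖x‖ ^ 2 := by positivity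
  linarith

/-- On the unit ball the Gaussian density is at least its peak times exp(-1/2). -/
lemma setLIntegral_le_stdGaussian {g : H → ℝ≥0∞} (hg : Measurable g) {s : Set H}
    (hs1 : ∀ x ∈ s, ‖x‖ ≤ 1) :
    ∫⁻ x in s, g x
      ≤ ENNReal.ofReal ((gaussianPeak H)⁻¹ * Real.exp (1 / 2)) * ∫⁻ x, g x ∂(stdGaussian H) := by
  rw [lintegral_stdGaussian hg, ← lintegral_const_mul _ (by fun_prop)]
  refine (setLIntegral_mono (g := fun x => _) (by fun_prop) fun x hx => ?_).trans
    (setLIntegral_le_lintegral _ _)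
  rw [← mul_assoc, ← ENNReal.ofReal_mul (by have := gaussianPeak_pos (H := H); positivity)]
  refine le_mul_of_one_le_left' ?_
  rw [← ENNReal.ofReal_one]
  refine ENNReal.ofReal_le_ofReal ?_
  have e : (gaussianPeak H)⁻¹ * Real.exp (1 / 2) * (gaussianPeak H * Real.exp (-‖x‖ ^ 2 / 2))
      = Real.exp (1 / 2 + -‖x‖ ^ 2 / 2) := by
    rw [Real.exp_add]
    have := gaussianPeak_pos (H := H)
    field_simp
  rw [e]
  refine Real.one_le_exp ?_
  have h1 := hs1 x hx
  have : ‖x‖ ^ 2 ≤ 1 := pow_le_one₀ (norm_nonneg _) h1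
  linarith

lemma lintegral_eq_det_mul_lintegral_comp (S : H →L[ℝ] H)
    (hS : LinearMap.det (S : H →ₗ[ℝ] H) ≠ 0) {g : H → ℝ≥0∞} (hg : Measurable g) :
    ∫⁻ x, g x = ENNReal.ofReal |LinearMap.det (S : H →ₗ[ℝ] H)| * ∫⁻ u, g (S u) := by
  have h := Measure.map_linearMap_addHaar_eq_smul_addHaar (volume : Measure H) hS
  have h2 : ∫⁻ u, g (S u) = ∫⁻ x, g x ∂(Measure.map (S : H →ₗ[ℝ] H) volume) := by
    rw [lintegral_map hg (by exact S.continuous.measurable)]; rfl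
  rw [h2, h, lintegral_smul_measure, smul_eq_mul, ← mul_assoc,
    ← ENNReal.ofReal_mul (abs_nonneg _), ← abs_mul, mul_inv_cancel₀ hS]
  simp

/-- Both images are centred Gaussians, and the hypothesis says that their covariances M M* and B B*
agree. -/
lemma stdGaussian_map_eq_of_norm_adjoint_eq {M : H →L[ℝ] E} {B : E →L[ℝ] E}
    (h : ∀ ξ, ‖B.adjoint ξ‖ = ‖M.adjoint ξ‖) :
    (stdGaussian H).map M = (stdGaussian E).map B := by
  have : IsProbabilityMeasure ((stdGaussian H).map M) :=
    Measure.isProbabilityMeasure_map (by fun_prop)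
  have : IsProbabilityMeasure ((stdGaussian E).map B) :=
    Measure.isProbabilityMeasure_map (by fun_prop)
  apply Measure.ext_of_charFun
  ext ξ
  have e1 : charFun ((stdGaussian H).map M) ξ = charFun (stdGaussian H) (M.adjoint ξ) := by
    rw [charFun_apply, charFun_apply, integral_map (by fun_prop) (by fun_prop)]
    simp only [ContinuousLinearMap.adjoint_inner_right]
  have e2 : charFun ((stdGaussian E).map B) ξ = charFun (stdGaussian E) (B.adjoint ξ) := by
    rw [charFun_apply, charFun_apply, integral_map (by fun_prop) (by fun_prop)]
    simp only [ContinuousLinearMap.adjoint_inner_right]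
  rw [e1, e2, charFun_stdGaussian, charFun_stdGaussian, h]

/-- Replacing `M` by the invertible endomorphism `B` gives the image of the Gaussian a density,
bounded by the peak divided by |det B|. -/
lemma lintegral_comp_stdGaussian_le {M : H →L[ℝ] E} {B : E →L[ℝ] E}
    (h : ∀ ξ, ‖B.adjoint ξ‖ = ‖M.adjoint ξ‖) (hB : LinearMap.det (B : E →ₗ[ℝ] E) ≠ 0)
    {g : E → ℝ≥0∞} (hg : Measurable g) :
    ∫⁻ x, g (M x) ∂(stdGaussian H)
      ≤ ENNReal.ofReal (gaussianPeak E * |LinearMap.det (B : E →ₗ[ℝ] E)|⁻¹) * ∫⁻ y, g y := by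
  rw [← lintegral_map hg M.continuous.measurable, stdGaussian_map_eq_of_norm_adjoint_eq h,
    lintegral_map hg B.continuous.measurable]
  refine (lintegral_stdGaussian_le (by fun_prop)).trans ?_
  rw [lintegral_eq_det_mul_lintegral_comp B hB hg, ← mul_assoc,
    ← ENNReal.ofReal_mul (by have := gaussianPeak_pos (H := E); positivity), mul_assoc,
    inv_mul_cancel₀ (abs_pos.2 hB).ne', mul_one]

end Density

/-! ### Test functions are regular for the heat flow. -/

section TestFunctions

variable {H : Type*} [NormedAddCommGroup H] [InnerProductSpace ℝ H] [FiniteDimensional ℝ H]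
  {E : Type*} [NormedAddCommGroup E] [InnerProductSpace ℝ E] [FiniteDimensional ℝ E]

/-- Nonnegative smooth functions of compact support. -/
structure IsTest (f : E → ℝ) : Prop where
  nonneg : ∀ x, 0 ≤ f x
  smooth : ContDiff ℝ 2 f
  support : HasCompactSupport f

/-- Adding `a` provides the positive lower bound that the heat flow argument needs. The other
constants do not depend on `a`, and any larger ones will do, so all indices can share them. The
field `w` is the gradient of f at M x, and the remainder estimate comes from its Lipschitz bound. -/
lemma IsTest.exists_heatRegular {f : E → ℝ} (hf : IsTest f) (M : H →L[ℝ] E) :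
    ∃ b K, 0 ≤ b ∧ 0 ≤ K ∧ ∀ a, 0 ≤ a → a ≤ 1 → ∀ b' K', b ≤ b' → K ≤ K' →
      HeatRegular M a b' K' (fun x => f (M x) + a) := by
  obtain ⟨B, hB⟩ := hf.support.exists_bound_of_continuous hf.smooth.continuous
  obtain ⟨C₁, hC₁⟩ := hf.smooth.lipschitzWith_of_hasCompactSupport hf.support (by norm_num)
  have hd : ContDiff ℝ 1 (fderiv ℝ f) := hf.smooth.fderiv_right (by norm_num)
  obtain ⟨C₂, hC₂⟩ := hd.lipschitzWith_of_hasCompactSupport (hf.support.fderiv ℝ) (by norm_num)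
  have hdiff : Differentiable ℝ f := hf.smooth.differentiable (by norm_num)
  have htaylor : ∀ y z, |f (y + z) - f y - fderiv ℝ f y z| ≤ C₂ * ‖z‖ ^ 2 := by
    intro y z
    have := (convex_closedBall y ‖z‖).norm_image_sub_le_of_norm_hasFDerivWithin_le'
      (f := f) (f' := fderiv ℝ f) (φ := fderiv ℝ f y) (C := C₂ * ‖z‖) (x := y) (y := y + z)
      (fun x _ => (hdiff x).hasFDerivAt.hasFDerivWithinAt) (fun x hx => ?_)
      (Metric.mem_closedBall_self (norm_nonneg _)) (by simp)
    · rw [add_sub_cancel_left] at this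
      rw [← Real.norm_eq_abs]
      refine this.trans (le_of_eq (by ring))
    · rw [← dist_eq_norm]
      exact (hC₂.dist_le_mul x y).trans (by gcongr; exact hx)
  refine ⟨|B| + 1, C₁ * ‖M‖ + C₁ + C₂ * ‖M‖ ^ 2, by positivity, by positivity, ?_⟩
  intro a ha ha1 b' K' hb' hK'
  have h1 : C₁ * ‖M‖ ≤ K' := by
    have : 0 ≤ C₁ + C₂ * ‖M‖ ^ 2 := by positivity
    linarith
  have h2 : C₁ ≤ K' := by
    have : 0 ≤ C₁ * ‖M‖ + C₂ * ‖M‖ ^ 2 := by positivity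
    linarith
  have h3 : C₂ * ‖M‖ ^ 2 ≤ K' := by
    have : 0 ≤ C₁ * ‖M‖ + C₁ := by positivity
    linarith
  refine ⟨fun x => ?_, fun x => ?_, fun x y => ?_,
    fun x => (InnerProductSpace.toDual ℝ E).symm (fderiv ℝ f (M x)), ?_, fun x => ?_,
    fun x y => ?_⟩
  · linarith [hf.nonneg (M x)]
  · have := hB (M x)
    rw [Real.norm_eq_abs] at this
    linarith [le_abs_self (f (M x)), le_abs_self B]
  · have := hC₁.dist_le_mul (M (x + y)) (M x)
    rw [Real.dist_eq, dist_eq_norm, map_add, add_sub_cancel_left] at this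
    rw [add_sub_add_right_eq_sub, map_add]
    refine this.trans ?_
    calc (C₁ : ℝ) * ‖M y‖ ≤ C₁ * (‖M‖ * ‖y‖) := by gcongr; exact M.le_opNorm y
      _ = C₁ * ‖M‖ * ‖y‖ := by ring
      _ ≤ K' * ‖y‖ := by gcongr
  · have := hd.continuous
    fun_prop
  · rw [LinearIsometryEquiv.norm_map]
    exact (norm_fderiv_le_of_lipschitz ℝ hC₁).trans h2
  · rw [InnerProductSpace.toDual_symm_apply, map_add]
    have e : f (M x + M y) + a - (f (M x) + a) - (fderiv ℝ f (M x)) (M y)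
      = f (M x + M y) - f (M x) - (fderiv ℝ f (M x)) (M y) := by ring
    rw [e]
    refine (htaylor _ _).trans ?_
    calc (C₂ : ℝ) * ‖M y‖ ^ 2 ≤ C₂ * (‖M‖ * ‖y‖) ^ 2 := by gcongr; exact M.le_opNorm y
      _ = C₂ * ‖M‖ ^ 2 * ‖y‖ ^ 2 := by ring
      _ ≤ K' * ‖y‖ ^ 2 := by gcongr

end TestFunctions

/-! ### From the Gaussian inequality to a localised Lebesgue inequality. -/

section GaussianToLebesgue

variable {ι : Type*} [Fintype ι]
  {H : Type*} [NormedAddCommGroup H] [InnerProductSpace ℝ H] [FiniteDimensional ℝ H]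
  [MeasurableSpace H] [BorelSpace H]
  {E : ι → Type*} [∀ j, NormedAddCommGroup (E j)] [∀ j, InnerProductSpace ℝ (E j)]
  [∀ j, FiniteDimensional ℝ (E j)] [∀ j, MeasurableSpace (E j)] [∀ j, BorelSpace (E j)]

/-- The Brascamp-Lieb inequality for the standard Gaussian measure, for test functions. -/
theorem integral_prod_rpow_le_of_isTest {p : ι → ℝ} (hp : ∀ j, 0 ≤ p j)
    (M : ∀ j, H →L[ℝ] E j)
    (hM : ∀ w : ∀ j, E j, ‖∑ j, p j • (M j).adjoint (w j)‖ ^ 2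
      ≤ ∑ j, p j * ‖(M j).adjoint (w j)‖ ^ 2) {f : ∀ j, E j → ℝ} (hf : ∀ j, IsTest (f j)) :
    ∫ x, ∏ j, f j (M j x) ^ p j ∂(stdGaussian H)
      ≤ ∏ j, (∫ x, f j (M j x) ∂(stdGaussian H)) ^ p j := by
  choose b K hb hK hreg using fun j => (hf j).exists_heatRegular (M j)
  set b' := 1 + ∑ j, b j with hb'
  set K' := ∑ j, K j with hK'
  have hbb : ∀ j, b j ≤ b' := fun j => by
    have := Finset.single_le_sum (f := b) (fun j _ => hb j) (Finset.mem_univ j)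
    linarith
  have hb1 : 1 ≤ b' := by
    have := Finset.sum_nonneg (f := b) (s := Finset.univ) fun j _ => hb j
    linarith
  have hKK : ∀ j, K j ≤ K' := fun j =>
    Finset.single_le_sum (f := K) (fun j _ => hK j) (Finset.mem_univ j)
  have hR : ∀ a, 0 ≤ a → a ≤ 1 → ∀ j, HeatRegular (M j) a b' K' (fun x => f j (M j x) + a) :=
    fun a ha ha1 j => hreg j a ha ha1 b' K' (hbb j) (hKK j)
  have hfint : ∀ j, Integrable (fun x => f j (M j x)) (stdGaussian H) := fun j => by
    simpa using (hR 0 le_rfl zero_le_one j).integrable 0 1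
  have hint : ∀ a, 0 ≤ a → a ≤ 1 →
      Integrable (fun x => ∏ j, (f j (M j x) + a) ^ p j) (stdGaussian H) := fun a ha ha1 =>
    Integrable.of_bound
      (continuous_prod_rpow hp fun j => (hR a ha ha1 j).continuous).aestronglyMeasurable _
      (Eventually.of_forall fun x => abs_prod_rpow_le hp
        (fun j => ha.trans ((hR a ha ha1 j).lower x)) fun j => (hR a ha ha1 j).upper x)
  have h1 : ∀ a, 0 < a → a ≤ 1 → ∫ x, ∏ j, f j (M j x) ^ p j ∂(stdGaussian H)
      ≤ ∏ j, (∫ x, f j (M j x) ∂(stdGaussian H) + a) ^ p j := by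
    intro a ha ha1
    have h2 := integral_prod_rpow_le_of_heatRegular hp M hM ha (ha1.trans hb1)
      (Finset.sum_nonneg fun j _ => hK j) (hR a ha.le ha1)
    have h3 : ∀ j, ∫ x, (f j (M j x) + a) ∂(stdGaussian H)
        = ∫ x, f j (M j x) ∂(stdGaussian H) + a := fun j => by
      rw [integral_add (hfint j) (integrable_const _)]; simp
    simp only [h3] at h2
    refine le_trans (integral_mono ?_ (hint a ha.le ha1) fun x => ?_) h2
    · simpa using hint 0 le_rfl zero_le_one
    · refine Finset.prod_le_prod (fun j _ => Real.rpow_nonneg ((hf j).nonneg _) _) fun j _ => ?_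
      exact Real.rpow_le_rpow ((hf j).nonneg _) (by linarith) (hp j)
  -- The positive shift is now removed by letting a decrease to 0.
  have ht : Tendsto (fun a : ℝ => ∏ j, (∫ x, f j (M j x) ∂(stdGaussian H) + a) ^ p j) (𝓝[>] 0)
      (𝓝 (∏ j, (∫ x, f j (M j x) ∂(stdGaussian H) + 0) ^ p j)) := by
    refine Tendsto.mono_left (Continuous.tendsto ?_ 0) nhdsWithin_le_nhds
    exact continuous_finsetProd _ fun j _ =>
      (continuous_const.add continuous_id).rpow_const fun _ => Or.inr (hp j)
  simp only [add_zero] at ht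
  refine ge_of_tendsto ht ?_
  filter_upwards [Ioc_mem_nhdsGT (zero_lt_one' ℝ)] with a ha using h1 a ha.1 ha.2

/-- A localised Brascamp-Lieb inequality on the image of the unit ball under `S`, where `S Sᵀ` is
an approximate extremiser. -/
theorem setLIntegral_prod_rpow_le_of_isTest {p : ι → ℝ} (hp : ∀ j, 0 ≤ p j)
    (L : ∀ j, H →L[ℝ] E j) (S : H →L[ℝ] H) (hS : LinearMap.det (S : H →ₗ[ℝ] H) ≠ 0)
    (B : ∀ j, E j →L[ℝ] E j) (hB : ∀ j, LinearMap.det (B j : E j →ₗ[ℝ] E j) ≠ 0)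
    (hLB : ∀ j ξ, ‖(B j).adjoint ξ‖ = ‖(L j ∘L S).adjoint ξ‖)
    (hM : ∀ w : ∀ j, E j, ‖∑ j, p j • (L j ∘L S).adjoint (w j)‖ ^ 2
      ≤ ∑ j, p j * ‖(L j ∘L S).adjoint (w j)‖ ^ 2) {f : ∀ j, E j → ℝ} (hf : ∀ j, IsTest (f j))
    {A : Set H} (hA : MeasurableSet A) (hAS : ∀ u, S u ∈ A → ‖u‖ ≤ 1) :
    ∫⁻ x in A, ∏ j, ENNReal.ofReal (f j (L j x)) ^ p j
      ≤ ENNReal.ofReal (|LinearMap.det (S : H →ₗ[ℝ] H)| * ((gaussianPeak H)⁻¹ * Real.exp (1 / 2)) *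
          ∏ j, (gaussianPeak (E j) * |LinearMap.det (B j : E j →ₗ[ℝ] E j)|⁻¹) ^ p j) *
        ∏ j, ENNReal.ofReal (∫ y, f j y) ^ p j := by
  set g : H → ℝ≥0∞ := fun x => ∏ j, ENNReal.ofReal (f j (L j x)) ^ p j with hg
  have hfm : ∀ j, Measurable (f j) := fun j => (hf j).smooth.continuous.measurable
  have hgm : Measurable g := by
    refine Finset.measurable_fun_prod _ fun j _ => ?_
    exact (((hfm j).comp (L j).continuous.measurable).ennreal_ofReal).pow_const _
  have hSm : Measurable S := S.continuous.measurable
  -- After x = S u the domain lies in the unit ball, where Lebesgue measure is dominated by a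
  -- multiple of the Gaussian.
  have step1 : ∫⁻ x in A, g x ≤ ENNReal.ofReal (|LinearMap.det (S : H →ₗ[ℝ] H)| *
      ((gaussianPeak H)⁻¹ * Real.exp (1 / 2))) * ∫⁻ u, g (S u) ∂(stdGaussian H) := by
    rw [← lintegral_indicator hA, lintegral_eq_det_mul_lintegral_comp S hS (hgm.indicator hA)]
    have e : ∀ u, A.indicator g (S u) = (S ⁻¹' A).indicator (fun u => g (S u)) u := fun u => rfl
    simp only [e]
    rw [lintegral_indicator (hSm hA), ENNReal.ofReal_mul (abs_nonneg _), mul_assoc]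
    gcongr
    exact setLIntegral_le_stdGaussian (hgm.comp hSm) hAS
  have hprod0 : ∀ u, 0 ≤ ∏ j, f j (L j (S u)) ^ p j := fun u =>
    Finset.prod_nonneg fun j _ => Real.rpow_nonneg ((hf j).nonneg _) _
  have hint0 : ∀ j, 0 ≤ ∫ x, f j (L j (S x)) ∂(stdGaussian H) := fun j =>
    integral_nonneg fun x => (hf j).nonneg _
  have step2 : ∫⁻ u, g (S u) ∂(stdGaussian H)
      ≤ ∏ j, (∫⁻ u, ENNReal.ofReal (f j (L j (S u))) ∂(stdGaussian H)) ^ p j := by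
    have h1 := integral_prod_rpow_le_of_isTest hp (fun j => L j ∘L S) hM hf
    simp only [ContinuousLinearMap.comp_apply] at h1
    have hc : ∀ j, Continuous fun x => f j (L j (S x)) := fun j => by
      have := (hf j).smooth.continuous
      fun_prop
    have hbd : ∀ j, ∃ C, ∀ y, ‖f j y‖ ≤ C := fun j =>
      (hf j).support.exists_bound_of_continuous (hf j).smooth.continuous
    choose C hC using hbd
    have hi1 : Integrable (fun u => ∏ j, f j (L j (S u)) ^ p j) (stdGaussian H) :=
      Integrable.of_bound (continuous_prod_rpow hp hc).aestronglyMeasurable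
        (∏ j, (1 + ∑ j, |C j|) ^ p j) (Eventually.of_forall fun u => abs_prod_rpow_le hp
          (fun j => (hf j).nonneg _) fun j => by
            have e1 := hC j (L j (S u))
            have e2 := Finset.single_le_sum (f := fun j => |C j|) (fun j _ => abs_nonneg _)
              (Finset.mem_univ j)
            rw [Real.norm_eq_abs] at e1
            linarith [le_abs_self (f j (L j (S u))), le_abs_self (C j)])
    have hi2 : ∀ j, Integrable (fun u => f j (L j (S u))) (stdGaussian H) := fun j =>
      Integrable.of_bound (hc j).aestronglyMeasurable (C j) (Eventually.of_forall fun u => hC j _)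
    have e1 : ∀ u, g (S u) = ENNReal.ofReal (∏ j, f j (L j (S u)) ^ p j) := fun u => by
      rw [ENNReal.ofReal_prod_of_nonneg fun j _ => Real.rpow_nonneg ((hf j).nonneg _) _]
      exact Finset.prod_congr rfl fun j _ =>
        ENNReal.ofReal_rpow_of_nonneg ((hf j).nonneg _) (hp j)
    have e2 : ∏ j, (∫⁻ u, ENNReal.ofReal (f j (L j (S u))) ∂(stdGaussian H)) ^ p j
        = ENNReal.ofReal (∏ j, (∫ x, f j (L j (S x)) ∂(stdGaussian H)) ^ p j) := by
      rw [ENNReal.ofReal_prod_of_nonneg fun j _ => Real.rpow_nonneg (hint0 j) _]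
      refine Finset.prod_congr rfl fun j _ => ?_
      rw [← ofReal_integral_eq_lintegral_ofReal (hi2 j)
        (Eventually.of_forall fun u => (hf j).nonneg _),
        ENNReal.ofReal_rpow_of_nonneg (hint0 j) (hp j)]
    simp only [e1]
    rw [e2, ← ofReal_integral_eq_lintegral_ofReal hi1 (Eventually.of_forall hprod0)]
    exact ENNReal.ofReal_le_ofReal h1
  have hpk : ∀ j, 0 ≤ gaussianPeak (E j) * |LinearMap.det (B j : E j →ₗ[ℝ] E j)|⁻¹ := fun j => by
    have := gaussianPeak_pos (H := E j)
    positivity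
  have step3 : ∏ j, (∫⁻ u, ENNReal.ofReal (f j (L j (S u))) ∂(stdGaussian H)) ^ p j
      ≤ ENNReal.ofReal (∏ j, (gaussianPeak (E j) *
          |LinearMap.det (B j : E j →ₗ[ℝ] E j)|⁻¹) ^ p j) *
        ∏ j, ENNReal.ofReal (∫ y, f j y) ^ p j := by
    rw [ENNReal.ofReal_prod_of_nonneg fun j _ => Real.rpow_nonneg (hpk j) _,
      ← Finset.prod_mul_distrib]
    refine Finset.prod_le_prod' fun j _ => ?_
    rw [← ENNReal.ofReal_rpow_of_nonneg (hpk j) (hp j), ← ENNReal.mul_rpow_of_nonneg _ _ (hp j)]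
    refine ENNReal.rpow_le_rpow ?_ (hp j)
    have hfi : Integrable (f j) := (hf j).smooth.continuous.integrable_of_hasCompactSupport
      (hf j).support
    rw [ofReal_integral_eq_lintegral_ofReal hfi (Eventually.of_forall (hf j).nonneg)]
    exact lintegral_comp_stdGaussian_le (M := L j ∘L S) (hLB j) (hB j) (hfm j).ennreal_ofReal
  refine step1.trans ?_
  rw [ENNReal.ofReal_mul (p := |LinearMap.det (S : H →ₗ[ℝ] H)| *
    ((gaussianPeak H)⁻¹ * Real.exp (1 / 2))) (by
      have := gaussianPeak_pos (H := H)
      positivity), mul_assoc]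
  gcongr
  exact step2.trans step3

end GaussianToLebesgue

end

section

open Filter Topology Matrix

/-! ### Cauchy-Binet and two-sided bounds for determinants with exponential weights. -/

section CauchyBinet

variable {κ ν : Type*} [Fintype κ] [DecidableEq κ] [Fintype ν] [DecidableEq ν]

/-- The Cauchy-Binet formula for `A D Aᵀ`, summed over all maps of index sets. -/
lemma factorial_mul_det_mul_diagonal_mul_transpose (A : Matrix κ ν ℝ) (d : ν → ℝ) :
    ((Fintype.card κ).factorial : ℝ) * (A * diagonal d * Aᵀ).det
      = ∑ f : κ → ν, (∏ i, d (f i)) * (A.submatrix id f).det ^ 2 := by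
  have h1 : (A * diagonal d * Aᵀ).det
      = ∑ f : κ → ν, (∏ i, d (f i)) * ((∏ i, A i (f i)) * (A.submatrix id f).det) := by
    rw [det_apply']
    have e : ∀ σ : Equiv.Perm κ, ∏ i, (A * diagonal d * Aᵀ) (σ i) i
        = ∑ f : κ → ν, ∏ i, (A (σ i) (f i) * d (f i) * A i (f i)) := fun σ => by
      have : ∀ i, (A * diagonal d * Aᵀ) (σ i) i = ∑ k, A (σ i) k * d k * A i k := fun i => by
        rw [Matrix.mul_apply]
        simp only [mul_diagonal, transpose_apply]
      simp only [this]
      rw [Finset.prod_univ_sum]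
      simp
    simp only [e, Finset.mul_sum]
    rw [Finset.sum_comm]
    refine Finset.sum_congr rfl fun f _ => ?_
    rw [det_apply', Finset.mul_sum, Finset.mul_sum]
    refine Finset.sum_congr rfl fun σ _ => ?_
    simp only [Finset.prod_mul_distrib, submatrix_apply, id]
    ring
  -- Reindexing f as f ∘ τ permutes the columns of the minor and brings out the sign of τ; summing
  -- over τ then rebuilds the second factor of the squared determinant.
  have h2 : ∀ τ : Equiv.Perm κ, (A * diagonal d * Aᵀ).det
      = ∑ f : κ → ν, (∏ i, d (f i)) *
        (((Equiv.Perm.sign τ : ℤ) : ℝ) * (∏ i, A i (f (τ i))) * (A.submatrix id f).det) := by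
    intro τ
    rw [h1, ← (Equiv.arrowCongr τ.symm (Equiv.refl ν)).sum_comp]
    refine Finset.sum_congr rfl fun f _ => ?_
    have e1 : (Equiv.arrowCongr τ.symm (Equiv.refl ν)) f = f ∘ τ := rfl
    have e2 : A.submatrix id (f ∘ τ) = (A.submatrix id f).submatrix id τ := rfl
    rw [e1, e2, det_permute']
    have e3 : ∏ i, d ((f ∘ τ) i) = ∏ i, d (f i) := Equiv.prod_comp τ fun i => d (f i)
    rw [e3]
    simp only [Function.comp_apply]
    ring
  calc ((Fintype.card κ).factorial : ℝ) * (A * diagonal d * Aᵀ).det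
      = ∑ τ : Equiv.Perm κ, (A * diagonal d * Aᵀ).det := by
        rw [Finset.sum_const, Finset.card_univ, Fintype.card_perm, nsmul_eq_mul]
    _ = ∑ f : κ → ν, ∑ τ : Equiv.Perm κ, (∏ i, d (f i)) *
        (((Equiv.Perm.sign τ : ℤ) : ℝ) * (∏ i, A i (f (τ i))) * (A.submatrix id f).det) := by
        rw [Finset.sum_comm]; exact Finset.sum_congr rfl fun τ _ => h2 τ
    _ = _ := by
        refine Finset.sum_congr rfl fun f _ => ?_
        have e : (A.submatrix id f).det = ∑ τ : Equiv.Perm κ,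
            ((Equiv.Perm.sign τ : ℤ) : ℝ) * ∏ i, A i (f (τ i)) := by
          rw [← det_transpose, det_apply']; rfl
        rw [← Finset.mul_sum, ← Finset.sum_mul, ← e, sq]

lemma det_mul_diagonal_exp_nonneg (A : Matrix κ ν ℝ) (μ : ν → ℝ) :
    0 ≤ (A * diagonal (fun i => Real.exp (μ i)) * Aᵀ).det := by
  have h := factorial_mul_det_mul_diagonal_mul_transpose A fun i => Real.exp (μ i)
  have h2 : 0 ≤ ((Fintype.card κ).factorial : ℝ)
      * (A * diagonal (fun i => Real.exp (μ i)) * Aᵀ).det := by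
    rw [h]; positivity
  exact nonneg_of_mul_nonneg_right h2 (by positivity)

/-- A single term of the nonnegative Cauchy-Binet sum. With `det_mul_diagonal_exp_le` it shows that
the determinant is comparable to the exponential of the largest ∑ μ (f i) over nonvanishing minors.
-/
lemma exp_mul_det_sq_le (A : Matrix κ ν ℝ) (μ : ν → ℝ) (f : κ → ν) :
    Real.exp (∑ i, μ (f i)) * ((A.submatrix id f).det ^ 2 / (Fintype.card κ).factorial)
      ≤ (A * diagonal (fun i => Real.exp (μ i)) * Aᵀ).det := by
  have h := factorial_mul_det_mul_diagonal_mul_transpose A fun i => Real.exp (μ i)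
  have h2 : (∏ i, Real.exp (μ (f i))) * (A.submatrix id f).det ^ 2
      ≤ ∑ f : κ → ν, (∏ i, Real.exp (μ (f i))) * (A.submatrix id f).det ^ 2 :=
    Finset.single_le_sum (f := fun f : κ → ν => (∏ i, Real.exp (μ (f i)))
      * (A.submatrix id f).det ^ 2) (fun f _ => by positivity) (Finset.mem_univ f)
  rw [← h, ← Real.exp_sum] at h2
  have hpos : (0 : ℝ) < (Fintype.card κ).factorial := by positivity
  rw [← mul_div_assoc, div_le_iff₀ hpos]
  linarith

lemma det_mul_diagonal_exp_le (A : Matrix κ ν ℝ) (μ : ν → ℝ) (m : ℝ)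
    (hm : ∀ f : κ → ν, (A.submatrix id f).det ≠ 0 → ∑ i, μ (f i) ≤ m) :
    (A * diagonal (fun i => Real.exp (μ i)) * Aᵀ).det ≤ Real.exp m * (A * Aᵀ).det := by
  have h := factorial_mul_det_mul_diagonal_mul_transpose A fun i => Real.exp (μ i)
  have h1 := factorial_mul_det_mul_diagonal_mul_transpose A fun _ => 1
  simp only [diagonal_one, Matrix.mul_one, Finset.prod_const_one, one_mul] at h1
  have hpos : (0 : ℝ) < (Fintype.card κ).factorial := by positivity
  refine le_of_mul_le_mul_left ?_ hpos
  rw [h, mul_left_comm, h1, Finset.mul_sum]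
  refine Finset.sum_le_sum fun f _ => ?_
  by_cases hf : (A.submatrix id f).det = 0
  · simp [hf]
  · rw [← Real.exp_sum]
    gcongr
    exact hm f hf

lemma exists_det_submatrix_ne_zero {A : Matrix κ ν ℝ} (hA : (A * Aᵀ).det ≠ 0) :
    ∃ f : κ → ν, (A.submatrix id f).det ≠ 0 := by
  by_contra! h
  have h1 := factorial_mul_det_mul_diagonal_mul_transpose A fun _ => 1
  simp [h, hA, Nat.factorial_ne_zero] at h1

lemma det_mul_diagonal_exp_pos {A : Matrix κ ν ℝ} (hA : (A * Aᵀ).det ≠ 0) (μ : ν → ℝ) :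
    0 < (A * diagonal (fun i => Real.exp (μ i)) * Aᵀ).det := by
  obtain ⟨f, hf⟩ := exists_det_submatrix_ne_zero hA
  exact lt_of_lt_of_le (by positivity) (exp_mul_det_sq_le A μ f)

end CauchyBinet

/-! ### Stability of Gaussian bounds under perturbation. -/

section GaussianBound

variable {ι : Type*} [Fintype ι] {κ : ι → Type*} [∀ j, Fintype (κ j)] [∀ j, DecidableEq (κ j)]
  {ν : Type*} [Fintype ν] [DecidableEq ν]

/-- The Brascamp-Lieb inequality with constant `C` for the diagonal Gaussians in the orthonormal
basis given by the columns of `U`. -/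
def DiagonalBound (A : ∀ j, Matrix (κ j) ν ℝ) (p : ι → ℝ) (C : ℝ) (U : Matrix ν ν ℝ) : Prop :=
  ∀ μ : ν → ℝ, Real.exp (∑ i, μ i)
    ≤ C * ∏ j, ((A j * U) * diagonal (fun i => Real.exp (μ i)) * (A j * U)ᵀ).det ^ p j

lemma DiagonalBound.mono {A : ∀ j, Matrix (κ j) ν ℝ} {p : ι → ℝ} {C C' : ℝ} {U : Matrix ν ν ℝ}
    (h : DiagonalBound A p C U) (hC : C ≤ C') : DiagonalBound A p C' U := fun μ =>
  (h μ).trans (mul_le_mul_of_nonneg_right hC (Finset.prod_nonneg fun _ _ =>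
    Real.rpow_nonneg (det_mul_diagonal_exp_nonneg _ _) _))

lemma mul_transpose_orthogonal {κ : Type*} [Fintype κ] (A : Matrix κ ν ℝ) {U : Matrix ν ν ℝ}
    (hU : U ∈ Matrix.orthogonalGroup ν ℝ) : (A * U) * (A * U)ᵀ = A * Aᵀ := by
  have : U * Uᵀ = 1 := (Matrix.mem_orthogonalGroup_iff ν ℝ).1 hU
  rw [transpose_mul, Matrix.mul_assoc, ← Matrix.mul_assoc U, this, Matrix.one_mul]

/-- Letting the eigenvalues degenerate, a Gaussian bound yields a piecewise linear inequality. -/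
lemma DiagonalBound.exists_sum_le {A : ∀ j, Matrix (κ j) ν ℝ} {p : ι → ℝ} (hp : ∀ j, 0 ≤ p j)
    {C : ℝ} {U : Matrix ν ν ℝ} (hU : U ∈ Matrix.orthogonalGroup ν ℝ)
    (h : DiagonalBound A p C U) (hA : ∀ j, (A j * (A j)ᵀ).det ≠ 0) (μ : ν → ℝ) :
    ∃ f : ∀ j, κ j → ν, (∀ j, ((A j * U).submatrix id (f j)).det ≠ 0) ∧
      ∑ i, μ i ≤ ∑ j, p j * ∑ i, μ (f j i) := by
  classical
  have hne : ∀ j, (Finset.univ.filter fun f : κ j → ν =>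
      ((A j * U).submatrix id f).det ≠ 0).Nonempty := fun j => by
    obtain ⟨f, hf⟩ := exists_det_submatrix_ne_zero (A := A j * U)
      (by rw [mul_transpose_orthogonal _ hU]; exact hA j)
    exact ⟨f, by simpa using hf⟩
  -- Among the nonvanishing minors, `f j` selects the one that dominates as the eigenvalues
  -- degenerate in the direction μ.
  choose f hf hmax using fun j => Finset.exists_max_image _ (fun f : κ j → ν => ∑ i, μ (f i)) (hne j)
  refine ⟨f, fun j => by simpa using hf j, ?_⟩
  by_contra! hlt
  set m := ∑ j, p j * ∑ i, μ (f j i) with hm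
  set Q := C * ∏ j, (A j * (A j)ᵀ).det ^ p j with hQ
  have hdet : ∀ j, 0 ≤ (A j * (A j)ᵀ).det := fun j => by
    simpa using det_mul_diagonal_exp_nonneg (A j) fun _ => 0
  have hCpos : 0 ≤ C := by
    by_contra! hC
    have h0 := h 0
    have : 0 ≤ ∏ j, ((A j * U) * diagonal (fun i => Real.exp ((0 : ν → ℝ) i))
        * (A j * U)ᵀ).det ^ p j := Finset.prod_nonneg fun j _ =>
      Real.rpow_nonneg (det_mul_diagonal_exp_nonneg _ _) _
    have := mul_nonpos_of_nonpos_of_nonneg hC.le this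
    linarith [Real.exp_pos (∑ i, (0 : ν → ℝ) i)]
  -- The bound is applied to s μ; a positive gap would force exponential growth in s below a fixed
  -- constant.
  have key : ∀ s : ℝ, 0 ≤ s → Real.exp (s * (∑ i, μ i - m)) ≤ Q := by
    intro s hs
    have h1 := h fun i => s * μ i
    have h2 : ∏ j, ((A j * U) * diagonal (fun i => Real.exp (s * μ i)) * (A j * U)ᵀ).det ^ p j
        ≤ Real.exp (s * m) * ∏ j, (A j * (A j)ᵀ).det ^ p j := by
      rw [hm, Finset.mul_sum, Real.exp_sum, ← Finset.prod_mul_distrib]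
      refine Finset.prod_le_prod
        (fun j _ => Real.rpow_nonneg (det_mul_diagonal_exp_nonneg _ _) _) fun j _ => ?_
      have h3 := det_mul_diagonal_exp_le (A j * U) (fun i => s * μ i) (s * ∑ i, μ (f j i))
        (fun g hg => by
          rw [← Finset.mul_sum]
          exact mul_le_mul_of_nonneg_left (hmax j g (by simpa using hg)) hs)
      rw [mul_transpose_orthogonal _ hU] at h3
      refine (Real.rpow_le_rpow (det_mul_diagonal_exp_nonneg _ _) h3 (hp j)).trans (le_of_eq ?_)
      rw [Real.mul_rpow (Real.exp_pos _).le (hdet j), ← Real.exp_mul]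
      congr 2; ring
    have h4 : Real.exp (∑ i, s * μ i) ≤ Real.exp (s * m) * Q :=
      h1.trans ((mul_le_mul_of_nonneg_left h2 hCpos).trans (le_of_eq (by rw [hQ]; ring)))
    rw [mul_sub, Real.exp_sub, div_le_iff₀ (Real.exp_pos _), Finset.mul_sum]
    linarith
  have hgap : 0 < ∑ i, μ i - m := by linarith
  -- This s gives exp |Q| ≤ Q, contradicting |Q| + 1 ≤ exp |Q|.
  have h5 := key (|Q| / (∑ i, μ i - m)) (by positivity)
  rw [div_mul_cancel₀ _ hgap.ne'] at h5
  linarith [Real.add_one_le_exp |Q|, le_abs_self Q]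

lemma isCompact_orthogonalGroup :
    IsCompact {U : Matrix ν ν ℝ | U ∈ Matrix.orthogonalGroup ν ℝ} := by
  have hc : IsCompact (Set.pi Set.univ fun _ : ν => Set.pi Set.univ fun _ : ν =>
      Set.Icc (-1 : ℝ) 1) :=
    isCompact_univ_pi fun _ => isCompact_univ_pi fun _ => isCompact_Icc
  refine hc.of_isClosed_subset ?_ ?_
  · have : {U : Matrix ν ν ℝ | U ∈ Matrix.orthogonalGroup ν ℝ}
        = {U : Matrix ν ν ℝ | U * Uᵀ = 1} := by
      ext U; exact Matrix.mem_orthogonalGroup_iff ν ℝ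
    rw [this]
    exact isClosed_eq (by fun_prop) continuous_const
  · intro U hU i _ j _
    have := entry_norm_bound_of_unitary (𝕜 := ℝ) hU i j
    rw [Real.norm_eq_abs] at this
    exact abs_le.1 this

/-- Gaussian bounds persist, uniformly, under small perturbations. -/
theorem exists_eventually_diagonalBound {A₀ : ∀ j, Matrix (κ j) ν ℝ} {p : ι → ℝ}
    (hp : ∀ j, 0 ≤ p j) {C : ℝ}
    (h : ∀ U ∈ Matrix.orthogonalGroup ν ℝ, DiagonalBound A₀ p C U)
    (hA : ∀ j, (A₀ j * (A₀ j)ᵀ).det ≠ 0) :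
    ∃ C' : ℝ, 0 < C' ∧ ∀ᶠ A in 𝓝 A₀, ∀ U ∈ Matrix.orthogonalGroup ν ℝ,
      DiagonalBound A p C' U := by
  -- The property is inherited by subsets and finite unions, so a neighbourhood of each U₀ suffices.
  refine IsCompact.induction_on (p := fun s => ∃ C' : ℝ, 0 < C' ∧ ∀ᶠ A in 𝓝 A₀, ∀ U ∈ s,
    DiagonalBound A p C' U) isCompact_orthogonalGroup ?_ ?_ ?_ ?_
  · exact ⟨1, one_pos, by simp⟩
  · rintro s t hst ⟨C', hC', ht⟩
    exact ⟨C', hC', ht.mono fun A hA U hU => hA U (hst hU)⟩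
  · rintro s t ⟨C₁, hC₁, hs⟩ ⟨C₂, hC₂, ht⟩
    refine ⟨max C₁ C₂, lt_max_of_lt_left hC₁, ?_⟩
    filter_upwards [hs, ht] with A h1 h2 U hU
    rcases hU with hU | hU
    · exact (h1 U hU).mono (le_max_left _ _)
    · exact (h2 U hU).mono (le_max_right _ _)
  · intro U₀ hU₀
    have hlow : ∀ j, ∀ f : κ j → ν, ∃ c : ℝ, 0 < c ∧
        (((A₀ j * U₀).submatrix id f).det ≠ 0 →
          ∀ᶠ q : (∀ j, Matrix (κ j) ν ℝ) × Matrix ν ν ℝ in 𝓝 A₀ ×ˢ 𝓝 U₀,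
            c ≤ ((q.1 j * q.2).submatrix id f).det ^ 2 / (Fintype.card (κ j)).factorial) := by
      intro j f
      by_cases hf : ((A₀ j * U₀).submatrix id f).det = 0
      · exact ⟨1, one_pos, fun h => absurd hf h⟩
      · refine ⟨((A₀ j * U₀).submatrix id f).det ^ 2 / (Fintype.card (κ j)).factorial / 2,
          by positivity, fun _ => ?_⟩
        have hc : Continuous fun q : (∀ j, Matrix (κ j) ν ℝ) × Matrix ν ν ℝ =>
            ((q.1 j * q.2).submatrix id f).det ^ 2 / (Fintype.card (κ j)).factorial := by
          have h1 : Continuous fun q : (∀ j, Matrix (κ j) ν ℝ) × Matrix ν ν ℝ => q.1 j * q.2 :=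
            ((continuous_apply j).comp continuous_fst).matrix_mul continuous_snd
          have h2 := (h1.matrix_submatrix id f).matrix_det
          exact (h2.pow 2).div_const _
        rw [← nhds_prod_eq]
        refine (hc.tendsto (A₀, U₀)).eventually_const_le ?_
        exact half_lt_self (by positivity)
    choose c hc0 hc using hlow
    -- A positive number below every `c j f`: the selection f supplied by `exists_sum_le` varies
    -- with μ, so the lower bound must not depend on f.
    set P : ι → ℝ := fun j => ∏ f : κ j → ν, min 1 (c j f) with hP
    have hP0 : ∀ j, 0 < P j := fun j => Finset.prod_pos fun f _ => lt_min one_pos (hc0 j f)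
    have hPc : ∀ j f, P j ≤ c j f := fun j f => by
      have h1 : P j ≤ min 1 (c j f) := by
        rw [hP]
        simp only
        rw [← Finset.mul_prod_erase Finset.univ (fun f => min 1 (c j f)) (Finset.mem_univ f)]
        refine mul_le_of_le_one_right (lt_min one_pos (hc0 j f)).le ?_
        exact Finset.prod_le_one (fun g _ => (lt_min one_pos (hc0 j g)).le)
          fun g _ => min_le_left _ _
      exact h1.trans (min_le_right _ _)
    have hall : ∀ᶠ q : (∀ j, Matrix (κ j) ν ℝ) × Matrix ν ν ℝ in 𝓝 A₀ ×ˢ 𝓝 U₀,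
        ∀ j, ∀ f : κ j → ν, ((A₀ j * U₀).submatrix id f).det ≠ 0 →
          c j f ≤ ((q.1 j * q.2).submatrix id f).det ^ 2 / (Fintype.card (κ j)).factorial := by
      refine eventually_all.2 fun j => eventually_all.2 fun f => ?_
      by_cases hf : ((A₀ j * U₀).submatrix id f).det = 0
      · exact Eventually.of_forall fun q h => absurd hf h
      · exact (hc j f hf).mono fun q hq _ => hq
    obtain ⟨s, hs, t, ht, hst⟩ := eventually_prod_iff.1 hall
    refine ⟨{U | t U}, mem_nhdsWithin_of_mem_nhds ht, (∏ j, P j ^ p j)⁻¹,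
      inv_pos.2 (Finset.prod_pos fun j _ => Real.rpow_pos_of_pos (hP0 j) _), ?_⟩
    filter_upwards [hs] with A hAs U hUt μ
    -- The linear inequality for μ comes from the unperturbed pair (A₀, U₀) but involves neither A
    -- nor U; only the lower bounds on minors are transferred to the perturbed pair.
    obtain ⟨f, hf, hμ⟩ := (h U₀ hU₀).exists_sum_le hp hU₀ hA μ
    have hPpos : 0 < ∏ j, P j ^ p j :=
      Finset.prod_pos fun j _ => Real.rpow_pos_of_pos (hP0 j) _
    rw [inv_mul_eq_div, le_div_iff₀ hPpos]
    calc Real.exp (∑ i, μ i) * ∏ j, P j ^ p j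
        ≤ Real.exp (∑ j, p j * ∑ i, μ (f j i)) * ∏ j, P j ^ p j := by gcongr
      _ = ∏ j, (Real.exp (∑ i, μ (f j i)) * P j) ^ p j := by
          rw [Real.exp_sum, ← Finset.prod_mul_distrib]
          refine Finset.prod_congr rfl fun j _ => ?_
          rw [Real.mul_rpow (Real.exp_pos _).le (hP0 j).le, ← Real.exp_mul, mul_comm (p j)]
      _ ≤ _ := by
          refine Finset.prod_le_prod (fun j _ => by have := hP0 j; positivity) fun j _ => ?_
          refine Real.rpow_le_rpow (by have := hP0 j; positivity) ?_ (hp j)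
          refine le_trans ?_ (exp_mul_det_sq_le (A j * U) μ (f j))
          gcongr
          exact (hPc j (f j)).trans (hst hAs hUt j (f j) (hf j))

end GaussianBound

end

section

open Filter Topology Matrix

/-! ### Spectral form of positive definite matrices and rank-one perturbations. -/

section Spectral

variable {ν : Type*} [Fintype ν] [DecidableEq ν]

lemma exists_orthogonal_diagonal_exp {N : Matrix ν ν ℝ} (hN : N.PosDef) :
    ∃ U ∈ Matrix.orthogonalGroup ν ℝ, ∃ μ : ν → ℝ,
      N = U * diagonal (fun i => Real.exp (μ i)) * Uᵀ := by
  refine ⟨hN.isHermitian.eigenvectorUnitary, hN.isHermitian.eigenvectorUnitary.2,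
    fun i => Real.log (hN.isHermitian.eigenvalues i), ?_⟩
  have h := hN.isHermitian.spectral_theorem
  have e : (fun i => Real.exp (Real.log (hN.isHermitian.eigenvalues i)))
      = RCLike.ofReal ∘ hN.isHermitian.eigenvalues := by
    ext i
    simp [Real.exp_log (hN.eigenvalues_pos i)]
  rw [e]
  simpa [Unitary.conjStarAlgAut_apply, star_eq_conjTranspose] using h

lemma mul_diagonal_exp_half_mul_transpose {κ : Type*} (A : Matrix κ ν ℝ) (μ : ν → ℝ) :
    (A * diagonal fun i => Real.exp (μ i / 2)) * (A * diagonal fun i => Real.exp (μ i / 2))ᵀ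
      = A * diagonal (fun i => Real.exp (μ i)) * Aᵀ := by
  rw [transpose_mul, diagonal_transpose, Matrix.mul_assoc, ← Matrix.mul_assoc (diagonal _),
    diagonal_mul_diagonal, ← Matrix.mul_assoc]
  congr 3
  ext i
  rw [← Real.exp_add, add_halves]

lemma exists_mul_transpose_eq {N : Matrix ν ν ℝ} (hN : N.PosDef) :
    ∃ B : Matrix ν ν ℝ, B * Bᵀ = N := by
  obtain ⟨U, -, μ, h⟩ := exists_orthogonal_diagonal_exp hN
  exact ⟨U * diagonal fun i => Real.exp (μ i / 2), by
    rw [h, mul_diagonal_exp_half_mul_transpose]⟩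

lemma det_sq_of_mem_orthogonalGroup {U : Matrix ν ν ℝ} (hU : U ∈ Matrix.orthogonalGroup ν ℝ) :
    U.det ^ 2 = 1 := by
  have h : U * Uᵀ = 1 := (Matrix.mem_orthogonalGroup_iff ν ℝ).1 hU
  have := congrArg Matrix.det h
  rwa [det_mul, det_transpose, det_one, ← sq] at this

lemma det_one_add_smul_vecMulVec (v : ν → ℝ) (s : ℝ) :
    (1 + s • vecMulVec v v).det = 1 + s * (v ⬝ᵥ v) := by
  have : s • vecMulVec v v = replicateCol Unit (s • v) * replicateRow Unit v := by
    rw [← vecMulVec_eq, smul_vecMulVec]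
  rw [this, det_one_add_replicateCol_mul_replicateRow, dotProduct_smul, smul_eq_mul]

lemma det_mul_one_add_smul_vecMulVec (B : Matrix ν ν ℝ) (v : ν → ℝ) (s : ℝ) :
    (B * (1 + s • vecMulVec v v) * Bᵀ).det = (B * Bᵀ).det * (1 + s * (v ⬝ᵥ v)) := by
  rw [det_mul, det_mul, det_mul, det_one_add_smul_vecMulVec]; ring

lemma mul_one_add_smul_vecMulVec_mul_transpose {κ : Type*} (M : Matrix κ ν ℝ) (v : ν → ℝ) (s : ℝ) :
    M * (1 + s • vecMulVec v v) * Mᵀ = M * Mᵀ + s • vecMulVec (M *ᵥ v) (M *ᵥ v) := by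
  rw [Matrix.mul_add, Matrix.mul_one, Matrix.add_mul, Matrix.mul_smul, Matrix.smul_mul,
    mul_vecMulVec, vecMulVec_mul, vecMul_transpose]

lemma posDef_one_add_smul_vecMulVec (v : ν → ℝ) {s : ℝ} (hs : |s| * (v ⬝ᵥ v) < 1) :
    (1 + s • vecMulVec v v).PosDef := by
  refine PosDef.of_dotProduct_mulVec_pos ?_ fun x hx => ?_
  · ext i j
    simp [vecMulVec_apply, Matrix.one_apply, mul_comm, eq_comm]
  · have hcs : (v ⬝ᵥ x) ^ 2 ≤ (v ⬝ᵥ v) * (x ⬝ᵥ x) := by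
      have := Finset.sum_mul_sq_le_sq_mul_sq Finset.univ v x
      simpa [dotProduct, sq] using this
    have hx0 : 0 < x ⬝ᵥ x := by
      have := dotProduct_star_self_pos_iff (v := x)
      simpa [hx] using this
    have e : star x ⬝ᵥ (1 + s • vecMulVec v v) *ᵥ x = x ⬝ᵥ x + s * (v ⬝ᵥ x) ^ 2 := by
      rw [add_mulVec, one_mulVec, smul_mulVec, vecMulVec_mulVec]
      simp only [star_trivial, op_smul_eq_smul, dotProduct_add, dotProduct_smul, smul_eq_mul,
        dotProduct_comm x v]
      ring
    rw [e]
    have h1 : |s * (v ⬝ᵥ x) ^ 2| ≤ |s| * (v ⬝ᵥ v) * (x ⬝ᵥ x) := by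
      rw [abs_mul, abs_of_nonneg (sq_nonneg (v ⬝ᵥ x)), mul_assoc]
      gcongr
    have h2 : |s| * (v ⬝ᵥ v) * (x ⬝ᵥ x) < x ⬝ᵥ x := by
      calc _ < 1 * (x ⬝ᵥ x) := by gcongr
        _ = _ := one_mul _
    linarith [neg_abs_le (s * (v ⬝ᵥ x) ^ 2)]

end Spectral

/-! ### Minimising the regularised Gaussian energy. -/

section Minimiser

variable {ι : Type*} [Fintype ι] {κ : ι → Type*} [∀ j, Fintype (κ j)] [∀ j, DecidableEq (κ j)]
  {ν : Type*} [Fintype ν] [DecidableEq ν]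

/-- The logarithmic Gaussian Brascamp-Lieb functional of a covariance matrix, regularised so that
it becomes coercive. -/
noncomputable def regEnergy (A : ∀ j, Matrix (κ j) ν ℝ) (p : ι → ℝ) (ε : ℝ) (N : Matrix ν ν ℝ) :
    ℝ :=
  ∑ j, p j * Real.log (A j * N * (A j)ᵀ).det - (1 + ε) * Real.log N.det + ε * N.trace

lemma regEnergy_diagonalised (A : ∀ j, Matrix (κ j) ν ℝ) (p : ι → ℝ) (ε : ℝ) {U : Matrix ν ν ℝ}
    (hU : U ∈ Matrix.orthogonalGroup ν ℝ) (μ : ν → ℝ) :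
    regEnergy A p ε (U * diagonal (fun i => Real.exp (μ i)) * Uᵀ)
      = ∑ j, p j * Real.log ((A j * U) * diagonal (fun i => Real.exp (μ i)) * (A j * U)ᵀ).det
        - (1 + ε) * ∑ i, μ i + ε * ∑ i, Real.exp (μ i) := by
  have h1 : (U * diagonal (fun i => Real.exp (μ i)) * Uᵀ).det = Real.exp (∑ i, μ i) := by
    rw [det_mul, det_mul, det_transpose, det_diagonal, Real.exp_sum, mul_right_comm, ← sq,
      det_sq_of_mem_orthogonalGroup hU, one_mul]
  have h2 : (U * diagonal (fun i => Real.exp (μ i)) * Uᵀ).trace = ∑ i, Real.exp (μ i) := by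
    have : Uᵀ * U = 1 := (Matrix.mem_orthogonalGroup_iff' ν ℝ).1 hU
    rw [trace_mul_comm, ← Matrix.mul_assoc, this, Matrix.one_mul, trace_diagonal]
  rw [regEnergy, h1, h2, Real.log_exp]
  simp only [transpose_mul, Matrix.mul_assoc]

lemma abs_le_exp_sub (x : ℝ) : |x| ≤ Real.exp x - x := by
  rcases le_total 0 x with hx | hx
  · rw [abs_of_nonneg hx]; linarith [Real.two_mul_le_exp (x := x)]
  · rw [abs_of_nonpos hx]; linarith [Real.exp_pos x]

variable {A : ∀ j, Matrix (κ j) ν ℝ} {p : ι → ℝ} {C : ℝ}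

/-- Coercivity: the Gaussian bound leaves at least ε ∑ (exp μ_i - μ_i) - log C of the energy, and
exp x - x ≥ |x|. -/
lemma mul_abs_le_of_diagonalBound (hC : 0 < C) (hA : ∀ j, (A j * (A j)ᵀ).det ≠ 0) {ε : ℝ}
    (hε : 0 < ε) {U : Matrix ν ν ℝ} (hU : U ∈ Matrix.orthogonalGroup ν ℝ)
    (h : DiagonalBound A p C U) (μ : ν → ℝ) (i : ν) :
    ε * |μ i| ≤ Real.log C
      + regEnergy A p ε (U * diagonal (fun i => Real.exp (μ i)) * Uᵀ) := by
  have hpos : ∀ j, 0 < ((A j * U) * diagonal (fun i => Real.exp (μ i)) * (A j * U)ᵀ).det :=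
    fun j => det_mul_diagonal_exp_pos (by rw [mul_transpose_orthogonal _ hU]; exact hA j) μ
  have h1 : ∑ i, μ i ≤ Real.log C + ∑ j, p j *
      Real.log ((A j * U) * diagonal (fun i => Real.exp (μ i)) * (A j * U)ᵀ).det := by
    have h2 := Real.log_le_log (Real.exp_pos _) (h μ)
    rw [Real.log_exp, Real.log_mul hC.ne'
      (Finset.prod_pos fun j _ => Real.rpow_pos_of_pos (hpos j) _).ne',
      Real.log_prod fun j _ => (Real.rpow_pos_of_pos (hpos j) _).ne'] at h2
    simpa only [Real.log_rpow (hpos _)] using h2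
  have h3 : |μ i| ≤ ∑ i, Real.exp (μ i) - ∑ i, μ i := by
    rw [← Finset.sum_sub_distrib]
    refine (abs_le_exp_sub (μ i)).trans
      (Finset.single_le_sum (f := fun i => Real.exp (μ i) - μ i) (fun k _ => ?_)
        (Finset.mem_univ i))
    exact (abs_nonneg _).trans (abs_le_exp_sub (μ k))
  rw [regEnergy_diagonalised A p ε hU]
  have h4 := mul_le_mul_of_nonneg_left h3 hε.le
  linarith

/-- By coercivity, outside a box of exponents the energy exceeds its value at the identity, so it is
minimised over the compact product of the orthogonal group and that box. -/
lemma exists_regEnergy_min (hC : 0 < C) (hA : ∀ j, (A j * (A j)ᵀ).det ≠ 0)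
    (h : ∀ U ∈ Matrix.orthogonalGroup ν ℝ, DiagonalBound A p C U) {ε : ℝ} (hε : 0 < ε) :
    ∃ U ∈ Matrix.orthogonalGroup ν ℝ, ∃ μ : ν → ℝ, ∀ N : Matrix ν ν ℝ, N.PosDef →
      regEnergy A p ε (U * diagonal (fun i => Real.exp (μ i)) * Uᵀ) ≤ regEnergy A p ε N := by
  set Φ : Matrix ν ν ℝ × (ν → ℝ) → ℝ := fun q =>
    ∑ j, p j * Real.log ((A j * q.1) * diagonal (fun i => Real.exp (q.2 i)) * (A j * q.1)ᵀ).det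
        - (1 + ε) * ∑ i, q.2 i + ε * ∑ i, Real.exp (q.2 i) with hΦ
  have hone : (1 : Matrix ν ν ℝ) ∈ Matrix.orthogonalGroup ν ℝ := one_mem _
  set R := (Real.log C + Φ (1, 0)) / ε with hR
  have hbox : ∀ U ∈ Matrix.orthogonalGroup ν ℝ, ∀ μ, Φ (U, μ) ≤ Φ (1, 0) → ∀ i, |μ i| ≤ R := by
    intro U hU μ hle i
    rw [hR, le_div_iff₀ hε, mul_comm]
    have := mul_abs_le_of_diagonalBound hC hA hε hU (h U hU) μ i
    rw [regEnergy_diagonalised A p ε hU] at this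
    exact this.trans (by linarith)
  set K : Set (Matrix ν ν ℝ × (ν → ℝ)) :=
    {U | U ∈ Matrix.orthogonalGroup ν ℝ} ×ˢ Set.pi Set.univ fun _ => Set.Icc (-R) R with hK
  have hKc : IsCompact K :=
    isCompact_orthogonalGroup.prod (isCompact_univ_pi fun _ => isCompact_Icc)
  have hmem : ((1 : Matrix ν ν ℝ), (0 : ν → ℝ)) ∈ K :=
    ⟨hone, fun i _ => abs_le.1 (hbox 1 hone 0 le_rfl i)⟩
  have hcont : ContinuousOn Φ K := by
    have hd : ∀ j, Continuous fun q : Matrix ν ν ℝ × (ν → ℝ) =>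
        ((A j * q.1) * diagonal (fun i => Real.exp (q.2 i)) * (A j * q.1)ᵀ).det := fun j => by
      have h1 : Continuous fun q : Matrix ν ν ℝ × (ν → ℝ) => A j * q.1 :=
        continuous_const.matrix_mul continuous_fst
      have h2 : Continuous fun q : Matrix ν ν ℝ × (ν → ℝ) =>
          diagonal (fun i => Real.exp (q.2 i)) :=
        Continuous.matrix_diagonal (by fun_prop)
      exact ((h1.matrix_mul h2).matrix_mul h1.matrix_transpose).matrix_det
    refine ContinuousOn.add (ContinuousOn.sub ?_ ?_) ?_
    · refine continuousOn_finsetSum _ fun j _ => ContinuousOn.mul continuousOn_const ?_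
      refine (hd j).continuousOn.log fun q hq => ?_
      exact (det_mul_diagonal_exp_pos
        (by rw [mul_transpose_orthogonal _ hq.1]; exact hA j) q.2).ne'
    · exact Continuous.continuousOn (by fun_prop)
    · exact Continuous.continuousOn (by fun_prop)
  obtain ⟨⟨U, μ⟩, ⟨hU, hμ⟩, hmin⟩ := hKc.exists_isMinOn ⟨_, hmem⟩ hcont
  refine ⟨U, hU, μ, fun N hN => ?_⟩
  obtain ⟨V, hV, lam, rfl⟩ := exists_orthogonal_diagonal_exp hN
  rw [regEnergy_diagonalised A p ε hU, regEnergy_diagonalised A p ε hV]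
  change Φ (U, μ) ≤ Φ (V, lam)
  have h0 : Φ (U, μ) ≤ Φ (1, 0) := hmin hmem
  by_cases hle : Φ (V, lam) ≤ Φ (1, 0)
  · exact hmin (show (V, lam) ∈ K from ⟨hV, fun i _ => abs_le.1 (hbox V hV lam hle i)⟩)
  · exact h0.trans (not_le.1 hle).le

/-- Almost extremal Gaussian inputs: a covariance matrix `S Sᵀ` whose normalised projections
satisfy the frame inequality up to the factor `1 + ε`, with quantitative control of its
eigenvalues. -/
theorem exists_almost_geometric (hC : 0 < C) (hA : ∀ j, (A j * (A j)ᵀ).det ≠ 0)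
    (h : ∀ U ∈ Matrix.orthogonalGroup ν ℝ, DiagonalBound A p C U) {ε : ℝ} (hε : 0 < ε) :
    ∃ U ∈ Matrix.orthogonalGroup ν ℝ, ∃ μ : ν → ℝ,
      (∀ i, ε * |μ i| ≤ Real.log C + ∑ j, p j * Real.log (A j * (A j)ᵀ).det
        + ε * Fintype.card ν) ∧
      ∀ (B : ∀ j, Matrix (κ j) (κ j) ℝ),
        (∀ j, B j * (B j)ᵀ = (A j * U) * diagonal (fun i => Real.exp (μ i)) * (A j * U)ᵀ) →
        ∀ v : ν → ℝ, ∀ u : ∀ j, κ j → ℝ,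
          (∀ j, B j *ᵥ u j = (A j * (U * diagonal fun i => Real.exp (μ i / 2))) *ᵥ v) →
          ∑ j, p j * (u j ⬝ᵥ u j) ≤ (1 + ε) * (v ⬝ᵥ v) := by
  obtain ⟨U, hU, μ, hmin⟩ := exists_regEnergy_min hC hA h hε
  refine ⟨U, hU, μ, fun i => ?_, ?_⟩
  -- The eigenvalue bound is coercivity combined with comparison of the minimum with the energy at
  -- the identity.
  · have h1 := mul_abs_le_of_diagonalBound hC hA hε hU (h U hU) μ i
    have h2 := hmin 1 PosDef.one
    have h3 : regEnergy A p ε 1 = ∑ j, p j * Real.log (A j * (A j)ᵀ).det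
        + ε * Fintype.card ν := by
      simp [regEnergy]
    linarith
  intro B hB v u hu
  set S := U * diagonal fun i => Real.exp (μ i / 2) with hS
  have hSS : S * Sᵀ = U * diagonal (fun i => Real.exp (μ i)) * Uᵀ :=
    mul_diagonal_exp_half_mul_transpose U μ
  have hSdet : S.det ≠ 0 := by
    have h1 := det_sq_of_mem_orthogonalGroup hU
    rw [hS, det_mul, det_diagonal]
    refine mul_ne_zero (fun h0 => by simp [h0] at h1) (Finset.prod_ne_zero_iff.2 fun i _ =>
      (Real.exp_pos _).ne')
  have hBB : ∀ j, B j * (B j)ᵀ = A j * (S * Sᵀ) * (A j)ᵀ := fun j => by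
    rw [hB, hSS, transpose_mul]; simp only [Matrix.mul_assoc]
  have hBpos : ∀ j, 0 < (B j * (B j)ᵀ).det := fun j => by
    rw [hB]
    exact det_mul_diagonal_exp_pos (by rw [mul_transpose_orthogonal _ hU]; exact hA j) μ
  set b := v ⬝ᵥ v with hb
  have hb0 : 0 ≤ b := by
    have := dotProduct_star_self_nonneg v
    simpa using this
  have hNdet : 0 < (S * Sᵀ).det := by
    rw [det_mul, det_transpose, ← sq]; positivity
  set c := (S *ᵥ v) ⬝ᵥ (S *ᵥ v) with hc
  have hc0 : 0 ≤ c := by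
    have := dotProduct_star_self_nonneg (S *ᵥ v)
    simpa using this
  set a : ι → ℝ := fun j => u j ⬝ᵥ u j with ha
  -- The variation N_s = S (1 + s v vᵀ) Sᵀ changes each image covariance by a rank-one term along
  -- u_j, so every determinant is explicit in s.
  have hNs : ∀ s : ℝ, regEnergy A p ε (S * (1 + s • vecMulVec v v) * Sᵀ)
      = ∑ j, p j * Real.log ((B j * (B j)ᵀ).det * (1 + s * a j))
        - (1 + ε) * Real.log ((S * Sᵀ).det * (1 + s * b)) + ε * ((S * Sᵀ).trace + s * c) := by
    intro s
    have e1 : ∀ j, A j * (S * (1 + s • vecMulVec v v) * Sᵀ) * (A j)ᵀ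
        = B j * (1 + s • vecMulVec (u j) (u j)) * (B j)ᵀ := fun j => by
      rw [mul_one_add_smul_vecMulVec_mul_transpose (B j), hu, hBB,
        mul_one_add_smul_vecMulVec_mul_transpose S, Matrix.mul_add, Matrix.add_mul,
        Matrix.mul_smul, Matrix.smul_mul, mul_vecMulVec, vecMulVec_mul, vecMul_transpose,
        mulVec_mulVec]
    rw [regEnergy, det_mul_one_add_smul_vecMulVec]
    simp only [e1, det_mul_one_add_smul_vecMulVec]
    rw [mul_one_add_smul_vecMulVec_mul_transpose, trace_add, trace_smul, trace_vecMulVec]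
    rfl
  set g : ℝ → ℝ := fun s => ∑ j, p j * Real.log ((B j * (B j)ᵀ).det * (1 + s * a j))
        - (1 + ε) * Real.log ((S * Sᵀ).det * (1 + s * b)) + ε * ((S * Sᵀ).trace + s * c) with hg
  have hlocmin : IsLocalMin g 0 := by
    have hev : ∀ᶠ s : ℝ in 𝓝 0, |s| * b < 1 := by
      have : Tendsto (fun s : ℝ => |s| * b) (𝓝 0) (𝓝 (|0| * b)) :=
        (continuous_abs.mul continuous_const).tendsto 0
      rw [abs_zero, zero_mul] at this
      exact this.eventually_lt_const one_pos
    refine hev.mono fun s hs => ?_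
    have hpd : (S * (1 + s • vecMulVec v v) * Sᵀ).PosDef := by
      have := (posDef_one_add_smul_vecMulVec v hs).mul_mul_conjTranspose_same (B := S)
        (vecMul_injective_of_isUnit ((isUnit_iff_isUnit_det S).2 hSdet.isUnit))
      simpa [conjTranspose_eq_transpose_of_trivial] using this
    have h1 := hmin _ hpd
    have h2 := hNs 0
    rw [zero_smul, add_zero, Matrix.mul_one] at h2
    rw [hNs s, ← hSS, h2] at h1
    exact h1
  have hlog : ∀ (D t : ℝ), D ≠ 0 → HasDerivAt (fun s : ℝ => Real.log (D * (1 + s * t))) t 0 := by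
    intro D t hD
    have h1 : HasDerivAt (fun s : ℝ => D * (1 + s * t)) (D * (1 * t)) 0 :=
      (((hasDerivAt_id (0 : ℝ)).mul_const t).const_add 1).const_mul D
    have h2 := h1.log (by simpa using hD)
    convert h2 using 1
    simp
    field_simp
  have hderiv : HasDerivAt g (∑ j, p j * a j - (1 + ε) * b + ε * (1 * c)) 0 := by
    refine HasDerivAt.add (HasDerivAt.sub ?_ ?_) ?_
    · exact HasDerivAt.fun_sum fun j _ => (hlog _ _ (hBpos j).ne').const_mul (p j)
    · exact (hlog _ _ hNdet.ne').const_mul _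
    · exact (((hasDerivAt_id (0 : ℝ)).mul_const c).const_add _).const_mul ε
  -- Stationarity gives ∑ p a + ε c = (1 + ε) b; discarding the nonnegative trace term ε c leaves
  -- the frame inequality.
  have h0 := hlocmin.hasDerivAt_eq_zero hderiv
  have : 0 ≤ ε * (1 * c) := by positivity
  linarith

end Minimiser

end

section

open MeasureTheory Filter Topology Matrix
open scoped ENNReal NNReal RealInnerProductSpace

/-! ### Linear maps as matrices in orthonormal bases. -/

section Coordinates

variable {H : Type*} [NormedAddCommGroup H] [InnerProductSpace ℝ H] [FiniteDimensional ℝ H]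
  {E : Type*} [NormedAddCommGroup E] [InnerProductSpace ℝ E] [FiniteDimensional ℝ E]
  {F : Type*} [NormedAddCommGroup F] [InnerProductSpace ℝ F] [FiniteDimensional ℝ F]

/-- The matrix of a linear map in the standard orthonormal bases. -/
noncomputable def toMat (L : H →L[ℝ] E) :
    Matrix (Fin (Module.finrank ℝ E)) (Fin (Module.finrank ℝ H)) ℝ :=
  LinearMap.toMatrix (stdOrthonormalBasis ℝ H).toBasis (stdOrthonormalBasis ℝ E).toBasis L

/-- The linear map with a given matrix in the standard orthonormal bases. -/
noncomputable def ofMat (A : Matrix (Fin (Module.finrank ℝ E)) (Fin (Module.finrank ℝ H)) ℝ) :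
    H →L[ℝ] E :=
  LinearMap.toContinuousLinearMap
    (Matrix.toLin (stdOrthonormalBasis ℝ H).toBasis (stdOrthonormalBasis ℝ E).toBasis A)

/-- Coordinates in the standard orthonormal basis. -/
noncomputable def coords (x : H) : Fin (Module.finrank ℝ H) → ℝ :=
  (stdOrthonormalBasis ℝ H).toBasis.repr x

lemma toMat_ofMat (A : Matrix (Fin (Module.finrank ℝ E)) (Fin (Module.finrank ℝ H)) ℝ) :
    toMat (ofMat A : H →L[ℝ] E) = A := by
  simp [toMat, ofMat]

lemma toMat_comp (K : E →L[ℝ] F) (L : H →L[ℝ] E) : toMat (K ∘L L) = toMat K * toMat L :=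
  LinearMap.toMatrix_comp _ _ _ _ _

lemma toMat_adjoint (L : H →L[ℝ] E) : toMat L.adjoint = (toMat L)ᵀ := by
  rw [← conjTranspose_eq_transpose_of_trivial]
  exact LinearMap.toMatrix_adjoint (stdOrthonormalBasis ℝ H) (stdOrthonormalBasis ℝ E) _

lemma toMat_injective : Function.Injective (toMat : (H →L[ℝ] E) → _) := fun K L h => by
  have := (LinearMap.toMatrix (stdOrthonormalBasis ℝ H).toBasis
    (stdOrthonormalBasis ℝ E).toBasis).injective h
  exact ContinuousLinearMap.coe_injective this

lemma det_toMat (S : H →L[ℝ] H) : (toMat S).det = LinearMap.det (S : H →ₗ[ℝ] H) :=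
  LinearMap.det_toMatrix _ _

lemma continuous_toMat : Continuous (toMat : (H →L[ℝ] E) → _) := by
  have : ∀ i j, Continuous fun L : H →L[ℝ] E => toMat L i j := fun i j => by
    have e : ∀ L : H →L[ℝ] E, toMat L i j
        = ⟪stdOrthonormalBasis ℝ E i, L (stdOrthonormalBasis ℝ H j)⟫ := fun L => by
      simp [toMat, LinearMap.toMatrix_apply, OrthonormalBasis.repr_apply_apply]
    simp only [e]
    fun_prop
  exact continuous_matrix this

lemma coords_apply (L : H →L[ℝ] E) (x : H) : coords (L x) = toMat L *ᵥ coords x :=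
  (LinearMap.toMatrix_mulVec_repr (stdOrthonormalBasis ℝ H).toBasis
    (stdOrthonormalBasis ℝ E).toBasis (L : H →ₗ[ℝ] E) x).symm

lemma coords_dotProduct_self (x : H) : coords x ⬝ᵥ coords x = ‖x‖ ^ 2 := by
  rw [← (stdOrthonormalBasis ℝ H).sum_sq_norm_inner_right x]
  simp [dotProduct, coords, OrthonormalBasis.repr_apply_apply, sq]

lemma norm_adjoint_eq_of_toMat {M : H →L[ℝ] E} {B : E →L[ℝ] E}
    (h : toMat B * (toMat B)ᵀ = toMat M * (toMat M)ᵀ) (ξ : E) :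
    ‖B.adjoint ξ‖ = ‖M.adjoint ξ‖ := by
  have h1 : B ∘L B.adjoint = M ∘L M.adjoint := by
    apply toMat_injective
    rw [toMat_comp, toMat_comp, toMat_adjoint, toMat_adjoint, h]
  have h2 : ‖B.adjoint ξ‖ ^ 2 = ‖M.adjoint ξ‖ ^ 2 := by
    rw [← real_inner_self_eq_norm_sq, ← real_inner_self_eq_norm_sq,
      ContinuousLinearMap.adjoint_inner_left, ContinuousLinearMap.adjoint_inner_left]
    exact congrArg (fun T : E →L[ℝ] E => ⟪ξ, T ξ⟫) h1
  exact (pow_left_inj₀ (norm_nonneg _) (norm_nonneg _) two_ne_zero).1 h2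

lemma surjective_of_det_ne_zero {B : E →L[ℝ] E} (hB : LinearMap.det (B : E →ₗ[ℝ] E) ≠ 0) :
    Function.Surjective B := fun y => by
  obtain ⟨x, hx⟩ := ((B : E →ₗ[ℝ] E).equivOfDetNeZero hB).surjective y
  exact ⟨x, hx⟩

/-- Thus `M` sends the unit ball of H into the image of the unit ball under `B`. With w = B* ξ, ‖w‖²
= ⟪ξ, M u⟫ = ⟪M* ξ, u⟫ ≤ ‖w‖ ‖u‖. -/
lemma norm_le_of_norm_adjoint_eq {M : H →L[ℝ] E} {B : E →L[ℝ] E}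
    (h : ∀ ξ, ‖B.adjoint ξ‖ = ‖M.adjoint ξ‖) (hB : LinearMap.det (B : E →ₗ[ℝ] E) ≠ 0)
    {w : E} {u : H} (hw : B w = M u) : ‖w‖ ≤ ‖u‖ := by
  have hB' : LinearMap.det (B.adjoint : E →ₗ[ℝ] E) ≠ 0 := by
    rw [← det_toMat, toMat_adjoint, det_transpose, det_toMat]; exact hB
  obtain ⟨ξ, rfl⟩ := surjective_of_det_ne_zero hB' w
  have h1 : ‖B.adjoint ξ‖ ^ 2 ≤ ‖u‖ * ‖B.adjoint ξ‖ := by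
    rw [← real_inner_self_eq_norm_sq, ContinuousLinearMap.adjoint_inner_right, hw, h,
      ← ContinuousLinearMap.adjoint_inner_right]
    exact real_inner_le_norm _ _
  rcases (norm_nonneg (B.adjoint ξ)).eq_or_lt with h0 | h0
  · rw [← h0]; exact norm_nonneg _
  · rw [sq] at h1; exact le_of_mul_le_mul_right h1 h0

/-- L is onto exactly when L L* is invertible, which makes surjectivity an open condition. -/
lemma surjective_iff_det_toMat_ne_zero (L : H →L[ℝ] E) :
    Function.Surjective L ↔ (toMat L * (toMat L)ᵀ).det ≠ 0 := by
  have e : (toMat L * (toMat L)ᵀ).det = LinearMap.det ((L ∘L L.adjoint : E →L[ℝ] E) : E →ₗ[ℝ] E) := by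
    rw [← det_toMat, toMat_comp, toMat_adjoint]
  rw [e]
  constructor
  · intro hL h0
    obtain ⟨ξ, hξ, hne⟩ := Submodule.exists_mem_ne_zero_of_ne_bot
      (LinearMap.bot_lt_ker_of_det_eq_zero h0).ne'
    obtain ⟨x, rfl⟩ := hL ξ
    have h1 : L (L.adjoint (L x)) = 0 := hξ
    have h2 : ‖L.adjoint (L x)‖ ^ 2 = 0 := by
      rw [← real_inner_self_eq_norm_sq, ContinuousLinearMap.adjoint_inner_left, h1,
        inner_zero_right]
    have h3 : L.adjoint (L x) = 0 := by simpa using h2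
    have h4 : ‖L x‖ ^ 2 = 0 := by
      rw [← real_inner_self_eq_norm_sq, ← ContinuousLinearMap.adjoint_inner_left, h3,
        inner_zero_left]
    exact hne (by simpa using h4)
  · intro h0 y
    obtain ⟨x, hx⟩ := surjective_of_det_ne_zero h0 y
    exact ⟨L.adjoint x, hx⟩

end Coordinates

/-! ### Duality between the frame inequality and the synthesis operator. -/

section Frame

variable {ι : Type*} [Fintype ι]
  {H : Type*} [NormedAddCommGroup H] [InnerProductSpace ℝ H] [FiniteDimensional ℝ H]
  {E : ι → Type*} [∀ j, NormedAddCommGroup (E j)] [∀ j, InnerProductSpace ℝ (E j)]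
  [∀ j, FiniteDimensional ℝ (E j)]

/-- Duality: a frame inequality for the normalised maps gives the contraction property of the
weighted synthesis operator. -/
lemma norm_sum_adjoint_sq_le {p : ι → ℝ} (hp : ∀ j, 0 ≤ p j) (M : ∀ j, H →L[ℝ] E j)
    (B : ∀ j, E j →L[ℝ] E j) (hB : ∀ j, LinearMap.det (B j : E j →ₗ[ℝ] E j) ≠ 0)
    (hMB : ∀ j ξ, ‖(B j).adjoint ξ‖ = ‖(M j).adjoint ξ‖)
    (hframe : ∀ (v : H) (u : ∀ j, E j), (∀ j, B j (u j) = M j v) →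
      ∑ j, p j * ‖u j‖ ^ 2 ≤ ‖v‖ ^ 2) (w : ∀ j, E j) :
    ‖∑ j, p j • (M j).adjoint (w j)‖ ^ 2 ≤ ∑ j, p j * ‖(M j).adjoint (w j)‖ ^ 2 := by
  set z := ∑ j, p j • (M j).adjoint (w j) with hz
  -- With B u = M z, ‖z‖² becomes a sum of pairings of u_j with B* w_j. Then 2ab ≤ a² + b², and the
  -- frame inequality for z absorbs one copy of ‖z‖².
  choose u hu using fun j => surjective_of_det_ne_zero (hB j) (M j z)
  have h1 : ‖z‖ ^ 2 = ∑ j, p j * ⟪u j, (B j).adjoint (w j)⟫ := by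
    rw [← real_inner_self_eq_norm_sq]
    nth_rewrite 2 [hz]
    rw [inner_sum]
    refine Finset.sum_congr rfl fun j _ => ?_
    rw [real_inner_smul_right, ContinuousLinearMap.adjoint_inner_right,
      ContinuousLinearMap.adjoint_inner_right, hu]
  have h2 : ∑ j, p j * (2 * ⟪u j, (B j).adjoint (w j)⟫)
      ≤ ∑ j, p j * (‖u j‖ ^ 2 + ‖(M j).adjoint (w j)‖ ^ 2) := by
    refine Finset.sum_le_sum fun j _ => mul_le_mul_of_nonneg_left ?_ (hp j)
    rw [← hMB]
    have := real_inner_le_norm (u j) ((B j).adjoint (w j))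
    have := two_mul_le_add_sq ‖u j‖ ‖(B j).adjoint (w j)‖
    linarith
  have h3 := hframe z u hu
  have h4 : ∑ j, p j * (2 * ⟪u j, (B j).adjoint (w j)⟫) = 2 * ‖z‖ ^ 2 := by
    rw [h1, Finset.mul_sum]; exact Finset.sum_congr rfl fun j _ => by ring
  simp only [mul_add, Finset.sum_add_distrib] at h2
  linarith

end Frame

/-! ### A finite Brascamp-Lieb constant implies Gaussian bounds. -/

section Necessity

variable {ι : Type*} [Fintype ι]
  {H : Type*} [NormedAddCommGroup H] [InnerProductSpace ℝ H] [FiniteDimensional ℝ H]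
  [MeasurableSpace H] [BorelSpace H]
  {E : ι → Type*} [∀ j, NormedAddCommGroup (E j)] [∀ j, InnerProductSpace ℝ (E j)]
  [∀ j, FiniteDimensional ℝ (E j)] [∀ j, MeasurableSpace (E j)] [∀ j, BorelSpace (E j)]

/-- The orthogonally diagonalised square root of a covariance matrix, with the square roots of its
images. -/
lemma exists_sqrt_maps (L : ∀ j, H →L[ℝ] E j) (hL : ∀ j, (toMat (L j) * (toMat (L j))ᵀ).det ≠ 0)
    {U : Matrix (Fin (Module.finrank ℝ H)) (Fin (Module.finrank ℝ H)) ℝ}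
    (hU : U ∈ Matrix.orthogonalGroup _ ℝ) (μ : Fin (Module.finrank ℝ H) → ℝ) :
    ∃ (S : H →L[ℝ] H) (B : ∀ j, E j →L[ℝ] E j),
      toMat S = (U * diagonal fun i => Real.exp (μ i / 2)) ∧
      |LinearMap.det (S : H →ₗ[ℝ] H)| ^ 2 = Real.exp (∑ i, μ i) ∧
      (∀ j, toMat (B j) * (toMat (B j))ᵀ
        = (toMat (L j) * U) * diagonal (fun i => Real.exp (μ i)) * (toMat (L j) * U)ᵀ) ∧
      (∀ j, LinearMap.det (B j : E j →ₗ[ℝ] E j) ≠ 0) ∧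
      ∀ j ξ, ‖(B j).adjoint ξ‖ = ‖(L j ∘L S).adjoint ξ‖ := by
  set Smat := U * diagonal fun i => Real.exp (μ i / 2) with hSmat
  have hpos : ∀ j, ((toMat (L j) * U) * diagonal (fun i => Real.exp (μ i))
      * (toMat (L j) * U)ᵀ).PosSemidef := fun j => by
    have h := mul_diagonal_exp_half_mul_transpose (toMat (L j) * U) μ
    rw [← h, ← conjTranspose_eq_transpose_of_trivial]
    exact posSemidef_self_mul_conjTranspose _
  have hdet : ∀ j, 0 < ((toMat (L j) * U) * diagonal (fun i => Real.exp (μ i))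
      * (toMat (L j) * U)ᵀ).det := fun j =>
    det_mul_diagonal_exp_pos (by rw [mul_transpose_orthogonal _ hU]; exact hL j) μ
  have hpd : ∀ j, ((toMat (L j) * U) * diagonal (fun i => Real.exp (μ i))
      * (toMat (L j) * U)ᵀ).PosDef := fun j =>
    (hpos j).posDef_iff_isUnit.2 ((isUnit_iff_isUnit_det _).2 (hdet j).ne'.isUnit)
  choose B hB using fun j => exists_mul_transpose_eq (hpd j)
  refine ⟨ofMat Smat, fun j => ofMat (B j), toMat_ofMat _, ?_, fun j => ?_, fun j => ?_,
    fun j => norm_adjoint_eq_of_toMat ?_⟩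
  · rw [sq_abs, ← det_toMat, toMat_ofMat, hSmat, det_mul, mul_pow,
      det_sq_of_mem_orthogonalGroup hU, one_mul, det_diagonal, ← Real.exp_sum, ← Real.exp_nat_mul,
      Finset.mul_sum]
    congr 1
    refine Finset.sum_congr rfl fun i _ => ?_
    push_cast; ring
  · rw [toMat_ofMat, hB]
  · intro h0
    rw [← det_toMat, toMat_ofMat] at h0
    have := hdet j
    rw [← hB, det_mul, h0] at this
    simp at this
  · rw [toMat_ofMat, hB, toMat_comp, toMat_ofMat, hSmat, ← Matrix.mul_assoc,
      mul_diagonal_exp_half_mul_transpose]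

/-- Testing the Brascamp-Lieb inequality on indicators of ellipsoids gives Gaussian bounds. -/
theorem exists_diagonalBound_of_holds {L : ∀ j, H →L[ℝ] E j} {p : ι → ℝ} (hp : ∀ j, 0 ≤ p j)
    (hL : ∀ j, Function.Surjective (L j)) {C : ℝ≥0∞} (hC : C ≠ ∞) (h : Holds L p C) :
    ∃ C' : ℝ, 0 < C' ∧ ∀ U ∈ Matrix.orthogonalGroup (Fin (Module.finrank ℝ H)) ℝ,
      DiagonalBound (fun j => toMat (L j)) p C' U := by
  obtain ⟨ω, hω⟩ : ∃ ω : ℝ, ω = (volume (Metric.closedBall (0 : H) 1)).toReal := ⟨_, rfl⟩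
  have hωpos : 0 < ω := by
    rw [hω]
    exact ENNReal.toReal_pos (Metric.measure_closedBall_pos volume (0 : H) one_pos).ne'
      measure_closedBall_lt_top.ne
  obtain ⟨ωE, hωE⟩ : ∃ ωE : ι → ℝ, ∀ j, ωE j = (volume (Metric.closedBall (0 : E j) 1)).toReal :=
    ⟨_, fun _ => rfl⟩
  have hωE0 : ∀ j, 0 ≤ ωE j := fun j => by rw [hωE]; exact ENNReal.toReal_nonneg
  set D := C.toReal * (∏ j, ωE j ^ p j) / ω with hD
  have hD0 : 0 ≤ D := div_nonneg (mul_nonneg ENNReal.toReal_nonneg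
    (Finset.prod_nonneg fun j _ => Real.rpow_nonneg (hωE0 j) _)) hωpos.le
  -- Squaring passes from |det S| to the determinant of the covariance S S*; adding 1 ensures
  -- positivity.
  refine ⟨D ^ 2 + 1, by positivity, fun U hU => DiagonalBound.mono ?_
    (C := D ^ 2) (by linarith)⟩
  intro μ
  obtain ⟨S, B, -, hS, hBB, hB, hLB⟩ := exists_sqrt_maps L
    (fun j => (surjective_iff_det_toMat_ne_zero _).1 (hL j)) hU μ
  -- The ellipsoids `T j` contain the images under L_j of the ellipsoid S(ball), so the product of
  -- their indicators is at least 1 there.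
  set T : ∀ j, Set (E j) := fun j => (B j) '' Metric.closedBall 0 1 with hT
  have hTc : ∀ j, IsCompact (T j) := fun j =>
    (isCompact_closedBall 0 1).image (B j).continuous
  have hTvol : ∀ j, volume.real (T j) = |LinearMap.det (B j : E j →ₗ[ℝ] E j)| * ωE j := fun j => by
    rw [hT, measureReal_def, Measure.addHaar_image_continuousLinearMap, ENNReal.toReal_mul,
      ENNReal.toReal_ofReal (abs_nonneg _), hωE]
  have hh := h (fun j => (T j).indicator fun _ => 1)
    (fun j x => Set.indicator_nonneg (fun _ _ => zero_le_one) x)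
    (fun j => (integrable_indicator_iff (hTc j).measurableSet).2
      (integrableOn_const (hTc j).measure_lt_top.ne))
  have hint : ∀ j, ∫ y, (T j).indicator (fun _ => (1 : ℝ)) y
      = |LinearMap.det (B j : E j →ₗ[ℝ] E j)| * ωE j := fun j => by
    rw [integral_indicator (hTc j).measurableSet, setIntegral_const, smul_eq_mul, mul_one, hTvol]
  simp only [hint] at hh
  have hlow : ENNReal.ofReal (|LinearMap.det (S : H →ₗ[ℝ] H)| * ω)
      ≤ ∫⁻ x : H, ∏ j, ENNReal.ofReal ((T j).indicator (fun _ => (1 : ℝ)) (L j x)) ^ p j := by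
    have hSc : IsCompact (S '' Metric.closedBall 0 1) :=
      (isCompact_closedBall 0 1).image S.continuous
    have e : ENNReal.ofReal (|LinearMap.det (S : H →ₗ[ℝ] H)| * ω)
        = volume (S '' Metric.closedBall 0 1) := by
      rw [Measure.addHaar_image_continuousLinearMap, ENNReal.ofReal_mul (abs_nonneg _), hω,
        ENNReal.ofReal_toReal measure_closedBall_lt_top.ne]
    rw [e, ← lintegral_indicator_one hSc.measurableSet]
    refine lintegral_mono fun x => ?_
    by_cases hx : x ∈ S '' Metric.closedBall 0 1
    · rw [Set.indicator_of_mem hx]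
      obtain ⟨u, hu, rfl⟩ := hx
      have : ∀ j, L j (S u) ∈ T j := fun j => by
        obtain ⟨w, hw⟩ := surjective_of_det_ne_zero (hB j) (L j (S u))
        refine ⟨w, ?_, hw⟩
        rw [mem_closedBall_zero_iff] at hu ⊢
        exact (norm_le_of_norm_adjoint_eq (hLB j) (hB j) hw).trans hu
      simp [Set.indicator_of_mem (this _)]
    · rw [Set.indicator_of_notMem hx]; exact zero_le
  have hreal : |LinearMap.det (S : H →ₗ[ℝ] H)| * ω
      ≤ C.toReal * ∏ j, (|LinearMap.det (B j : E j →ₗ[ℝ] E j)| * ωE j) ^ p j := by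
    have h1 := hlow.trans hh
    have hn : ∀ j, 0 ≤ |LinearMap.det (B j : E j →ₗ[ℝ] E j)| * ωE j := fun j =>
      mul_nonneg (abs_nonneg _) (hωE0 j)
    have e : C * ∏ j, ENNReal.ofReal (|LinearMap.det (B j : E j →ₗ[ℝ] E j)| * ωE j) ^ p j
        = ENNReal.ofReal (C.toReal *
          ∏ j, (|LinearMap.det (B j : E j →ₗ[ℝ] E j)| * ωE j) ^ p j) := by
      rw [ENNReal.ofReal_mul ENNReal.toReal_nonneg, ENNReal.ofReal_toReal hC,
        ENNReal.ofReal_prod_of_nonneg fun j _ => Real.rpow_nonneg (hn j) _]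
      congr 1
      exact Finset.prod_congr rfl fun j _ => ENNReal.ofReal_rpow_of_nonneg (hn j) (hp j)
    rw [e] at h1
    exact (ENNReal.ofReal_le_ofReal_iff (mul_nonneg ENNReal.toReal_nonneg
      (Finset.prod_nonneg fun j _ => Real.rpow_nonneg (hn j) _))).1 h1
  have hbound : |LinearMap.det (S : H →ₗ[ℝ] H)|
      ≤ D * ∏ j, |LinearMap.det (B j : E j →ₗ[ℝ] E j)| ^ p j := by
    rw [hD, div_mul_eq_mul_div, le_div_iff₀ hωpos]
    refine hreal.trans (le_of_eq ?_)
    rw [mul_assoc, ← Finset.prod_mul_distrib]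
    congr 1
    refine Finset.prod_congr rfl fun j _ => ?_
    rw [Real.mul_rpow (abs_nonneg _) (hωE0 j), mul_comm]
  have hsq := pow_le_pow_left₀ (abs_nonneg _) hbound 2
  rw [hS, mul_pow, ← Finset.prod_pow] at hsq
  refine hsq.trans (le_of_eq ?_)
  congr 1
  refine Finset.prod_congr rfl fun j _ => ?_
  rw [← hBB, det_mul, det_transpose, ← sq, det_toMat,
    ← sq_abs (LinearMap.det (B j : E j →ₗ[ℝ] E j)), ← Real.rpow_natCast,
    ← Real.rpow_natCast, ← Real.rpow_mul (abs_nonneg _), ← Real.rpow_mul (abs_nonneg _), mul_comm]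

end Necessity

end

section

open MeasureTheory Filter Topology Matrix
open scoped ENNReal NNReal RealInnerProductSpace

/-! ### Approximation of integrable functions by test functions. -/

section Approximation

variable {E : Type*} [NormedAddCommGroup E] [InnerProductSpace ℝ E] [FiniteDimensional ℝ E]
  [MeasurableSpace E] [BorelSpace E]

lemma eLpNorm_two_eq_ofReal_sqrt {g : E → ℝ} (hg : MemLp g 2 volume) :
    eLpNorm g 2 volume = ENNReal.ofReal √(∫ x, g x ^ 2) := by
  rw [hg.eLpNorm_eq_integral_rpow_norm (by norm_num) (by norm_num), Real.sqrt_eq_rpow]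
  simp

/-- Approximating √f in L² and squaring keeps the approximants smooth and nonnegative. The triangle
inequality in L² bounds their integrals by `b`, and a subsequence converges almost everywhere. -/
lemma exists_isTest_tendsto {f : E → ℝ} (hf : ∀ x, 0 ≤ f x) (hi : Integrable f) :
    ∃ (h : ℕ → E → ℝ) (b : ℕ → ℝ), (∀ k, IsTest (h k)) ∧
      (∀ᵐ x, Tendsto (fun k => h k x) atTop (𝓝 (f x))) ∧ (∀ k, ∫ x, h k x ≤ b k) ∧
      Tendsto b atTop (𝓝 (∫ x, f x)) := by
  have hsq : (fun x => √(f x) ^ 2) = f := funext fun x => Real.sq_sqrt (hf x)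
  have hm : AEStronglyMeasurable (fun x => √(f x)) volume :=
    Real.continuous_sqrt.comp_aestronglyMeasurable hi.1
  have hL : MemLp (fun x => √(f x)) 2 volume := by
    rw [memLp_two_iff_integrable_sq hm, hsq]; exact hi
  choose g hgc hgs hg using fun k : ℕ =>
    hL.exist_eLpNorm_sub_le (by norm_num) (by norm_num) (ε := 1 / ((k : ℝ) + 1)) (by positivity)
  have hgL : ∀ k, MemLp (g k) 2 volume := fun k =>
    (hgs k).continuous.memLp_of_hasCompactSupport (hgc k)
  have hlim : Tendsto (fun k : ℕ => 1 / ((k : ℝ) + 1)) atTop (𝓝 0) :=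
    tendsto_one_div_add_atTop_nhds_zero_nat
  have hto : Tendsto (fun k => eLpNorm (g k - fun x => √(f x)) 2 volume) atTop (𝓝 0) := by
    have h1 : Tendsto (fun k : ℕ => ENNReal.ofReal (1 / ((k : ℝ) + 1))) atTop (𝓝 0) := by
      simpa using ENNReal.tendsto_ofReal hlim
    refine tendsto_of_tendsto_of_tendsto_of_le_of_le tendsto_const_nhds h1 (fun _ => zero_le)
      fun k => ?_
    change eLpNorm (g k - fun x => √(f x)) 2 volume ≤ _
    rw [eLpNorm_sub_comm]
    exact hg k
  obtain ⟨ns, hns, hae⟩ := (tendstoInMeasure_of_tendsto_eLpNorm (by norm_num)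
    (fun k => (hgL k).1) hm hto).exists_seq_tendsto_ae
  refine ⟨fun k x => g (ns k) x ^ 2, fun k => (√(∫ x, f x) + 1 / ((ns k : ℝ) + 1)) ^ 2,
    fun k => ⟨fun x => sq_nonneg _, ?_, ?_⟩, ?_, fun k => ?_, ?_⟩
  · exact (contDiff_infty.1 (hgs _) 2).pow 2
  · have : (fun x => g (ns k) x ^ 2) = g (ns k) * g (ns k) := by ext x; simp [sq]
    change HasCompactSupport fun x => g (ns k) x ^ 2
    rw [this]
    exact (hgc _).mul_left
  · filter_upwards [hae] with x hx
    have := hx.pow 2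
    rwa [Real.sq_sqrt (hf x)] at this
  · have h1 : eLpNorm (g (ns k)) 2 volume ≤ eLpNorm (fun x => √(f x)) 2 volume
        + ENNReal.ofReal (1 / ((ns k : ℝ) + 1)) := by
      have e : g (ns k) = (fun x => √(f x)) + (g (ns k) - fun x => √(f x)) := by simp
      calc eLpNorm (g (ns k)) 2 volume
          ≤ eLpNorm (fun x => √(f x)) 2 volume
            + eLpNorm (g (ns k) - fun x => √(f x)) 2 volume := by
            conv_lhs => rw [e]
            exact eLpNorm_add_le hm ((hgL _).1.sub hm) (by norm_num)
        _ ≤ _ := by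
            gcongr
            rw [eLpNorm_sub_comm]
            exact hg _
    rw [eLpNorm_two_eq_ofReal_sqrt (hgL _), eLpNorm_two_eq_ofReal_sqrt hL, hsq,
      ← ENNReal.ofReal_add (Real.sqrt_nonneg _) (by positivity),
      ENNReal.ofReal_le_ofReal_iff (by positivity)] at h1
    calc ∫ x, g (ns k) x ^ 2 = √(∫ x, g (ns k) x ^ 2) ^ 2 :=
          (Real.sq_sqrt (integral_nonneg fun x => sq_nonneg _)).symm
      _ ≤ _ := pow_le_pow_left₀ (Real.sqrt_nonneg _) h1 2
  · have h1 : Tendsto (fun k => (√(∫ x, f x) + 1 / ((ns k : ℝ) + 1)) ^ 2) atTop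
        (𝓝 ((√(∫ x, f x) + 0) ^ 2)) :=
      (tendsto_const_nhds.add (hlim.comp hns.tendsto_atTop)).pow 2
    rwa [add_zero, Real.sq_sqrt (integral_nonneg hf)] at h1

end Approximation

/-! ### Gaussian bounds imply the Brascamp-Lieb inequality. -/

section Sufficiency

variable {ι : Type*} [Fintype ι]
  {H : Type*} [NormedAddCommGroup H] [InnerProductSpace ℝ H] [FiniteDimensional ℝ H]
  [MeasurableSpace H] [BorelSpace H]
  {E : ι → Type*} [∀ j, NormedAddCommGroup (E j)] [∀ j, InnerProductSpace ℝ (E j)]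
  [∀ j, FiniteDimensional ℝ (E j)] [∀ j, MeasurableSpace (E j)] [∀ j, BorelSpace (E j)]

lemma gaussianPeak_le_one : gaussianPeak H ≤ 1 := by
  refine inv_le_one_of_one_le₀ (Real.one_le_rpow ?_ (by positivity))
  linarith [Real.pi_gt_three]

/-- The frame inequality is invariant under multiplying the covariance by exp τ. This freedom is
used to dilate S so that the preimage of a prescribed ball lies in the unit ball. -/
lemma rescaled_frame {p : ι → ℝ} {ε : ℝ} (L : ∀ j, H →L[ℝ] E j) (S : H →L[ℝ] H)
    (B : ∀ j, E j →L[ℝ] E j)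
    {U : Matrix (Fin (Module.finrank ℝ H)) (Fin (Module.finrank ℝ H)) ℝ}
    {μ : Fin (Module.finrank ℝ H) → ℝ} (τ : ℝ)
    (hframe : ∀ (B : ∀ j, Matrix (Fin (Module.finrank ℝ (E j))) (Fin (Module.finrank ℝ (E j))) ℝ),
      (∀ j, B j * (B j)ᵀ
        = (toMat (L j) * U) * diagonal (fun i => Real.exp (μ i)) * (toMat (L j) * U)ᵀ) →
      ∀ v, ∀ u : ∀ j, Fin (Module.finrank ℝ (E j)) → ℝ,
        (∀ j, B j *ᵥ u j = (toMat (L j) * (U * diagonal fun i => Real.exp (μ i / 2))) *ᵥ v) →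
        ∑ j, p j * (u j ⬝ᵥ u j) ≤ (1 + ε) * (v ⬝ᵥ v))
    (hS : toMat S = U * diagonal fun i => Real.exp ((μ i + τ) / 2))
    (hB : ∀ j, toMat (B j) * (toMat (B j))ᵀ
      = (toMat (L j) * U) * diagonal (fun i => Real.exp (μ i + τ)) * (toMat (L j) * U)ᵀ)
    (v : H) (u : ∀ j, E j) (hu : ∀ j, B j (u j) = (L j ∘L S) v) :
    ∑ j, p j * ‖u j‖ ^ 2 ≤ (1 + ε) * ‖v‖ ^ 2 := by
  have d1 : (diagonal fun i => Real.exp (μ i + τ))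
      = Real.exp τ • diagonal fun i => Real.exp (μ i) := by
    rw [← diagonal_smul]; congr 1; ext i
    rw [Real.exp_add, Pi.smul_apply, smul_eq_mul, mul_comm]
  have d2 : (diagonal fun i => Real.exp ((μ i + τ) / 2))
      = Real.exp (τ / 2) • diagonal fun i => Real.exp (μ i / 2) := by
    rw [← diagonal_smul]; congr 1; ext i
    rw [add_div, Real.exp_add, Pi.smul_apply, smul_eq_mul, mul_comm]
  have e2 : Real.exp (-(τ / 2)) * Real.exp (τ / 2) = 1 := by rw [← Real.exp_add]; simp
  have e1 : Real.exp (-(τ / 2)) * Real.exp (-(τ / 2)) * Real.exp τ = 1 := by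
    rw [← Real.exp_add, ← Real.exp_add, Real.exp_eq_one_iff]; ring
  have h := hframe (fun j => Real.exp (-(τ / 2)) • toMat (B j)) (fun j => by
    rw [transpose_smul, Matrix.smul_mul, Matrix.mul_smul, hB, d1, Matrix.mul_smul,
      Matrix.smul_mul, smul_smul, smul_smul, e1, one_smul]) (coords v) (fun j => coords (u j))
    (fun j => by
      rw [smul_mulVec, ← coords_apply, hu, coords_apply, toMat_comp, hS, d2, Matrix.mul_smul,
        Matrix.mul_smul, smul_mulVec, smul_smul, e2, one_smul])
  simpa only [coords_dotProduct_self] using h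

/-- The Brascamp-Lieb inequality on a ball with perturbed exponents, with constants controlled by
the Gaussian constant. -/
theorem setLIntegral_prod_rpow_le_of_diagonalBound {L : ∀ j, H →L[ℝ] E j} {p : ι → ℝ}
    (hp : ∀ j, 0 ≤ p j) {C D : ℝ} (hC : 0 < C)
    (hL : ∀ j, (toMat (L j) * (toMat (L j))ᵀ).det ≠ 0)
    (h : ∀ U ∈ Matrix.orthogonalGroup (Fin (Module.finrank ℝ H)) ℝ,
      DiagonalBound (fun j => toMat (L j)) p C U)
    (hD : ∑ j, p j * Real.log (toMat (L j) * (toMat (L j))ᵀ).det ≤ D) {ε R : ℝ} (hε : 0 < ε)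
    (hR : 0 < R) {f : ∀ j, E j → ℝ} (hf : ∀ j, IsTest (f j)) :
    ∫⁻ x in Metric.closedBall (0 : H) R,
        ∏ j, ENNReal.ofReal (f j (L j x)) ^ (p j / (1 + ε))
      ≤ ENNReal.ofReal ((gaussianPeak H)⁻¹ * Real.exp (1 / 2) *
          Real.exp ((Module.finrank ℝ H * (2 * (|Real.log C| + |D|)
            + 2 * ε * (Module.finrank ℝ H + |Real.log R|)) + |Real.log C|) / 2)) *
        ∏ j, ENNReal.ofReal (∫ y, f j y) ^ (p j / (1 + ε)) := by
  set n : ℝ := ((Module.finrank ℝ H : ℕ) : ℝ) with hn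
  have hn0 : 0 ≤ n := Nat.cast_nonneg _
  obtain ⟨U, hU, μ, hμ, hframe⟩ := exists_almost_geometric hC hL h hε
  set K₀ := |Real.log C| + |D| with hK₀
  have hK₀0 : 0 ≤ K₀ := by positivity
  set m := (K₀ + ε * n) / ε with hm
  have hm0 : 0 ≤ m := by positivity
  have hεm : ε * m = K₀ + ε * n := by rw [hm]; field_simp
  have hμm : ∀ i, |μ i| ≤ m := fun i => by
    rw [hm, le_div_iff₀ hε, mul_comm]
    have h1 := hμ i
    rw [Fintype.card_fin] at h1
    linarith [le_abs_self (Real.log C), le_abs_self D]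
  -- Chosen so that all eigenvalues exp(μ_i + τ) of S Sᵀ are at least R², whence ‖S u‖ ≥ R ‖u‖.
  set τ := 2 * Real.log R + m with hτ
  obtain ⟨S, B, hSmat, hS, hBB, hB, hLB⟩ := exists_sqrt_maps L hL hU fun i => μ i + τ
  have hε1 : 0 < 1 + ε := by linarith
  have hp' : ∀ j, 0 ≤ p j / (1 + ε) := fun j => div_nonneg (hp j) hε1.le
  have hSdet : LinearMap.det (S : H →ₗ[ℝ] H) ≠ 0 := by
    intro h0
    rw [h0] at hS
    have := Real.exp_pos (∑ i, (μ i + τ))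
    rw [← hS] at this
    simp at this
  -- Dividing the exponents by 1 + ε cancels the factor in the frame inequality exactly.
  have hM := norm_sum_adjoint_sq_le hp' (fun j => L j ∘L S) B hB hLB fun v u hu => by
    have h1 := rescaled_frame L S B τ hframe hSmat hBB v u hu
    have h2 : ∑ j, p j / (1 + ε) * ‖u j‖ ^ 2 = (∑ j, p j * ‖u j‖ ^ 2) / (1 + ε) := by
      rw [Finset.sum_div]; exact Finset.sum_congr rfl fun j _ => by ring
    rw [h2, div_le_iff₀ hε1]
    linarith
  have hball : ∀ u, S u ∈ Metric.closedBall (0 : H) R → ‖u‖ ≤ 1 := by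
    intro u hu
    rw [mem_closedBall_zero_iff] at hu
    have e1 : ‖S u‖ ^ 2 = ∑ i, Real.exp (μ i + τ) * coords u i ^ 2 := by
      have hUU : Uᵀ * U = 1 := (Matrix.mem_orthogonalGroup_iff' _ ℝ).1 hU
      rw [← coords_dotProduct_self, coords_apply, hSmat, ← mulVec_mulVec, dotProduct_mulVec,
        ← mulVec_transpose, mulVec_mulVec, hUU, one_mulVec]
      simp only [dotProduct, mulVec_diagonal]
      refine Finset.sum_congr rfl fun i _ => ?_
      have : Real.exp (μ i + τ) = Real.exp ((μ i + τ) / 2) * Real.exp ((μ i + τ) / 2) := by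
        rw [← Real.exp_add, add_halves]
      rw [this]; ring
    have e2 : R ^ 2 * ‖u‖ ^ 2 ≤ ‖S u‖ ^ 2 := by
      rw [e1, ← coords_dotProduct_self u, dotProduct, Finset.mul_sum]
      refine Finset.sum_le_sum fun i _ => ?_
      rw [← sq]
      refine mul_le_mul_of_nonneg_right ?_ (sq_nonneg _)
      calc R ^ 2 = Real.exp (2 * Real.log R) := by
            rw [two_mul, Real.exp_add, Real.exp_log hR, sq]
        _ ≤ Real.exp (μ i + τ) := by
            refine Real.exp_le_exp.2 ?_
            have := (abs_le.1 (hμm i)).1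
            rw [hτ]; linarith
    have e3 : R ^ 2 * ‖u‖ ^ 2 ≤ R ^ 2 * 1 := by
      rw [mul_one]; exact e2.trans (pow_le_pow_left₀ (norm_nonneg _) hu 2)
    have e4 : ‖u‖ ^ 2 ≤ 1 := le_of_mul_le_mul_left e3 (by positivity)
    exact (sq_le_one_iff₀ (norm_nonneg _)).1 e4
  refine (setLIntegral_prod_rpow_le_of_isTest hp' L S hSdet B hB hLB hM hf
    Metric.isClosed_closedBall.measurableSet hball).trans ?_
  gcongr ENNReal.ofReal ?_ * _
  have hY : ∀ j, 0 < |LinearMap.det (B j : E j →ₗ[ℝ] E j)| := fun j => abs_pos.2 (hB j)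
  set σ := ∑ i, (μ i + τ) with hσ
  set y := ∑ j, p j * (2 * Real.log |LinearMap.det (B j : E j →ₗ[ℝ] E j)|) with hy
  have hX : |LinearMap.det (S : H →ₗ[ℝ] H)| = Real.exp (σ / 2) := by
    refine (pow_left_inj₀ (abs_nonneg _) (Real.exp_pos _).le two_ne_zero).1 ?_
    rw [hS, ← Real.exp_nat_mul]
    congr 1; push_cast; ring
  -- The Gaussian bound at the dilated covariance, in logarithmic form.
  have hσy : σ ≤ Real.log C + y := by
    have h1 := h U hU fun i => μ i + τ
    have e : ∏ j, ((toMat (L j) * U) * diagonal (fun i => Real.exp (μ i + τ))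
        * (toMat (L j) * U)ᵀ).det ^ p j = Real.exp y := by
      rw [hy, Real.exp_sum]
      refine Finset.prod_congr rfl fun j _ => ?_
      rw [← hBB, det_mul, det_transpose, ← sq, det_toMat,
        ← sq_abs (LinearMap.det (B j : E j →ₗ[ℝ] E j)), Real.rpow_def_of_pos (pow_pos (hY j) 2),
        Real.log_pow]
      congr 1; push_cast; ring
    rw [e, ← Real.exp_log hC, ← Real.exp_add, Real.exp_le_exp] at h1
    simpa using h1
  have hprod : ∏ j, (gaussianPeak (E j) * |LinearMap.det (B j : E j →ₗ[ℝ] E j)|⁻¹)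
      ^ (p j / (1 + ε)) ≤ Real.exp (-(y / (1 + ε)) / 2) := by
    have e : -(y / (1 + ε)) / 2 = ∑ j, (p j / (1 + ε)) *
        Real.log (|LinearMap.det (B j : E j →ₗ[ℝ] E j)|⁻¹) := by
      rw [hy, neg_div, Finset.sum_div, Finset.sum_div, ← Finset.sum_neg_distrib]
      refine Finset.sum_congr rfl fun j _ => ?_
      rw [Real.log_inv]; ring
    rw [e, Real.exp_sum]
    refine Finset.prod_le_prod (fun j _ => Real.rpow_nonneg ?_ _) fun j _ => ?_
    · have := gaussianPeak_pos (H := E j)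
      positivity
    · have h1 : 0 < |LinearMap.det (B j : E j →ₗ[ℝ] E j)|⁻¹ := inv_pos.2 (hY j)
      rw [mul_comm (p j / (1 + ε)), ← Real.rpow_def_of_pos h1]
      refine Real.rpow_le_rpow ?_ ?_ (hp' j)
      · have := gaussianPeak_pos (H := E j)
        positivity
      · exact mul_le_of_le_one_left h1.le gaussianPeak_le_one
  have hpk := gaussianPeak_pos (H := H)
  -- Perturbing the exponents leaves the uncancelled quantity (ε σ + log C)/(1 + ε). Although σ may
  -- be of order 1/ε, ε m = K₀ + ε n keeps ε σ bounded.
  have hexp : σ / 2 + -(y / (1 + ε)) / 2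
      ≤ (n * (2 * K₀ + 2 * ε * (n + |Real.log R|)) + |Real.log C|) / 2 := by
    have hσ1 : σ ≤ n * (2 * m + 2 * |Real.log R|) := by
      have : ∀ i ∈ (Finset.univ : Finset (Fin (Module.finrank ℝ H))),
          μ i + τ ≤ 2 * m + 2 * |Real.log R| := fun i _ => by
        have := (abs_le.1 (hμm i)).2
        rw [hτ]; linarith [le_abs_self (Real.log R)]
      have h2 := Finset.sum_le_card_nsmul _ _ _ this
      rw [Finset.card_univ, Fintype.card_fin, nsmul_eq_mul] at h2
      exact h2
    have h1 : (σ - Real.log C) / (1 + ε) ≤ y / (1 + ε) := by gcongr; linarith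
    have h2 : σ - (σ - Real.log C) / (1 + ε) = (ε * σ + Real.log C) / (1 + ε) := by
      field_simp; ring
    have h3 : (ε * σ + Real.log C) / (1 + ε)
        ≤ n * (2 * K₀ + 2 * ε * (n + |Real.log R|)) + |Real.log C| := by
      have h4 : ε * σ ≤ n * (2 * K₀ + 2 * ε * (n + |Real.log R|)) := by
        calc ε * σ ≤ ε * (n * (2 * m + 2 * |Real.log R|)) := by gcongr
          _ = n * (2 * (ε * m) + 2 * ε * |Real.log R|) := by ring
          _ = _ := by rw [hεm]; ring
      rw [div_le_iff₀ hε1]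
      have h5 : 0 ≤ n * (2 * K₀ + 2 * ε * (n + |Real.log R|)) + |Real.log C| := by positivity
      have h6 := mul_nonneg h5 hε.le
      linarith [le_abs_self (Real.log C)]
    linarith
  calc |LinearMap.det (S : H →ₗ[ℝ] H)| * ((gaussianPeak H)⁻¹ * Real.exp (1 / 2)) *
          ∏ j, (gaussianPeak (E j) * |LinearMap.det (B j : E j →ₗ[ℝ] E j)|⁻¹) ^ (p j / (1 + ε))
      ≤ Real.exp (σ / 2) * ((gaussianPeak H)⁻¹ * Real.exp (1 / 2))
          * Real.exp (-(y / (1 + ε)) / 2) := by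
        rw [hX]; gcongr
    _ = (gaussianPeak H)⁻¹ * Real.exp (1 / 2)
          * Real.exp (σ / 2 + -(y / (1 + ε)) / 2) := by rw [Real.exp_add]; ring
    _ ≤ _ := by gcongr

lemma tendsto_rpow_one {c : ℝ≥0∞} (hc : c ≠ ∞) {s : ℕ → ℝ} (hs0 : ∀ k, 0 < s k)
    (hs : Tendsto s atTop (𝓝 1)) : Tendsto (fun k => c ^ s k) atTop (𝓝 c) := by
  lift c to ℝ≥0 using hc
  have h1 : ∀ k, (c : ℝ≥0∞) ^ s k = ((c ^ s k : ℝ≥0) : ℝ≥0∞) := fun k =>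
    (ENNReal.coe_rpow_of_nonneg c (hs0 k).le).symm
  simp only [h1]
  refine ENNReal.tendsto_coe.2 ?_
  rcases eq_or_ne c 0 with rfl | h0
  · refine tendsto_const_nhds.congr fun k => (NNReal.zero_rpow (hs0 k).ne').symm
  · have := (NNReal.continuousAt_rpow (x := c) (y := 1) (Or.inl h0)).tendsto.comp
      (tendsto_const_nhds.prodMk_nhds hs)
    rw [NNReal.rpow_one] at this
    exact this

lemma prod_ofReal_rpow_ne_top {p : ι → ℝ} (hp : ∀ j, 0 ≤ p j) (a : ι → ℝ) :
    ∏ j, ENNReal.ofReal (a j) ^ p j ≠ ∞ :=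
  ENNReal.prod_ne_top fun j _ => ENNReal.rpow_ne_top_of_nonneg (hp j) ENNReal.ofReal_ne_top

lemma prod_rpow_div {p : ι → ℝ} {ε : ℝ} (hε : 0 < 1 + ε) (a : ι → ℝ≥0∞) :
    ∏ j, a j ^ (p j / (1 + ε)) = (∏ j, a j ^ p j) ^ (1 / (1 + ε)) := by
  rw [← ENNReal.prod_rpow_of_nonneg (by positivity)]
  refine Finset.prod_congr rfl fun j _ => ?_
  rw [← ENNReal.rpow_mul, mul_one_div]

lemma measurable_prod_ofReal_rpow {p : ι → ℝ} (L : ∀ j, H →L[ℝ] E j) {f : ∀ j, E j → ℝ}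
    (hf : ∀ j, IsTest (f j)) :
    Measurable fun x => ∏ j, ENNReal.ofReal (f j (L j x)) ^ p j := by
  refine Finset.measurable_fun_prod _ fun j _ => ?_
  exact ((((hf j).smooth.continuous.measurable).comp
    (L j).continuous.measurable).ennreal_ofReal).pow_const _

/-- A Gaussian bound implies the Brascamp-Lieb inequality for test functions. -/
theorem lintegral_prod_rpow_le_of_diagonalBound {L : ∀ j, H →L[ℝ] E j} {p : ι → ℝ}
    (hp : ∀ j, 0 ≤ p j) {C D : ℝ} (hC : 0 < C)
    (hL : ∀ j, (toMat (L j) * (toMat (L j))ᵀ).det ≠ 0)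
    (h : ∀ U ∈ Matrix.orthogonalGroup (Fin (Module.finrank ℝ H)) ℝ,
      DiagonalBound (fun j => toMat (L j)) p C U)
    (hD : ∑ j, p j * Real.log (toMat (L j) * (toMat (L j))ᵀ).det ≤ D)
    {f : ∀ j, E j → ℝ} (hf : ∀ j, IsTest (f j)) :
    ∫⁻ x : H, ∏ j, ENNReal.ofReal (f j (L j x)) ^ p j
      ≤ ENNReal.ofReal ((gaussianPeak H)⁻¹ * Real.exp (1 / 2) *
          Real.exp ((Module.finrank ℝ H * (2 * (|Real.log C| + |D|)) + |Real.log C|) / 2)) *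
        ∏ j, ENNReal.ofReal (∫ y, f j y) ^ p j := by
  set K := ENNReal.ofReal ((gaussianPeak H)⁻¹ * Real.exp (1 / 2) *
          Real.exp ((Module.finrank ℝ H * (2 * (|Real.log C| + |D|)) + |Real.log C|) / 2)) *
        ∏ j, ENNReal.ofReal (∫ y, f j y) ^ p j with hK
  set G : H → ℝ≥0∞ := fun x => ∏ j, ENNReal.ofReal (f j (L j x)) ^ p j with hG
  have hGm : Measurable G := measurable_prod_ofReal_rpow L hf
  -- For fixed R the radius enters the constant only through ε |log R|, so in the limit ε → 0 the
  -- bound `K` is independent of R.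
  have hlocal : ∀ R : ℝ, 0 < R → ∫⁻ x in Metric.closedBall (0 : H) R, G x ≤ K := by
    intro R hR
    set e : ℕ → ℝ := fun k => 1 / ((k : ℝ) + 1) with he
    have he0 : ∀ k, 0 < e k := fun k => by positivity
    have helim : Tendsto e atTop (𝓝 0) := tendsto_one_div_add_atTop_nhds_zero_nat
    set s : ℕ → ℝ := fun k => 1 / (1 + e k) with hs
    have hs0 : ∀ k, 0 < s k := fun k => by have := he0 k; positivity
    have hslim : Tendsto s atTop (𝓝 1) := by
      have h1 : Tendsto (fun k => (1 : ℝ) / (1 + e k)) atTop (𝓝 (1 / (1 + 0))) :=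
        tendsto_const_nhds.div (helim.const_add 1) (by norm_num)
      rwa [add_zero, div_one] at h1
    set Θ : ℝ → ℝ := fun ε => (gaussianPeak H)⁻¹ * Real.exp (1 / 2) *
          Real.exp ((Module.finrank ℝ H * (2 * (|Real.log C| + |D|)
            + 2 * ε * (Module.finrank ℝ H + |Real.log R|)) + |Real.log C|) / 2) with hΘ
    have hΘc : Continuous Θ := by fun_prop
    have hk : ∀ k, ∫⁻ x in Metric.closedBall (0 : H) R, G x ^ s k
        ≤ ENNReal.ofReal (Θ (e k)) * (∏ j, ENNReal.ofReal (∫ y, f j y) ^ p j) ^ s k := by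
      intro k
      have h1 := setLIntegral_prod_rpow_le_of_diagonalBound hp hC hL h hD (he0 k) hR hf
      have h2 : 0 < 1 + e k := by linarith [he0 k]
      simpa only [prod_rpow_div h2] using h1
    have hlim : Tendsto (fun k => ENNReal.ofReal (Θ (e k)) *
        (∏ j, ENNReal.ofReal (∫ y, f j y) ^ p j) ^ s k) atTop (𝓝 K) := by
      have h1 : Tendsto (fun k => ENNReal.ofReal (Θ (e k))) atTop (𝓝 (ENNReal.ofReal (Θ 0))) :=
        ENNReal.tendsto_ofReal ((hΘc.tendsto 0).comp helim)
      have h2 := tendsto_rpow_one (prod_ofReal_rpow_ne_top hp fun j => ∫ y, f j y) hs0 hslim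
      have h3 := ENNReal.Tendsto.mul h1 (Or.inr (prod_ofReal_rpow_ne_top hp _)) h2
        (Or.inr ENNReal.ofReal_ne_top)
      have h4 : Θ 0 = (gaussianPeak H)⁻¹ * Real.exp (1 / 2) *
          Real.exp ((Module.finrank ℝ H * (2 * (|Real.log C| + |D|)) + |Real.log C|) / 2) := by
        rw [hΘ]; simp
      rwa [h4] at h3
    -- Fatou's lemma, since G^{1/(1+ε)} converges pointwise to G; vanishing G causes no trouble
    -- because the exponents are positive.
    calc ∫⁻ x in Metric.closedBall (0 : H) R, G x
        = ∫⁻ x in Metric.closedBall (0 : H) R, liminf (fun k => G x ^ s k) atTop := by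
          refine lintegral_congr fun x => ?_
          exact ((tendsto_rpow_one (prod_ofReal_rpow_ne_top hp _) hs0 hslim).liminf_eq).symm
      _ ≤ liminf (fun k => ∫⁻ x in Metric.closedBall (0 : H) R, G x ^ s k) atTop :=
          lintegral_liminf_le fun k => hGm.pow_const _
      _ ≤ liminf (fun k => ENNReal.ofReal (Θ (e k)) *
            (∏ j, ENNReal.ofReal (∫ y, f j y) ^ p j) ^ s k) atTop :=
          liminf_le_liminf (Eventually.of_forall hk)
      _ = K := hlim.liminf_eq
  have hU : ⋃ k : ℕ, Metric.closedBall (0 : H) ((k : ℝ) + 1) = Set.univ := by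
    refine Set.eq_univ_of_forall fun x => Set.mem_iUnion.2 ?_
    obtain ⟨k, hk⟩ := exists_nat_ge ‖x‖
    exact ⟨k, by rw [mem_closedBall_zero_iff]; linarith⟩
  have hdir : Directed (· ⊆ ·) fun k : ℕ => Metric.closedBall (0 : H) ((k : ℝ) + 1) :=
    Monotone.directed_le fun a b hab => Metric.closedBall_subset_closedBall (by
      have : (a : ℝ) ≤ b := by exact_mod_cast hab
      linarith)
  rw [← setLIntegral_univ, ← hU, setLIntegral_iUnion_of_directed _ hdir]
  exact iSup_le fun k => hlocal _ (by positivity)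

/-- Test functions suffice in the Brascamp-Lieb inequality. -/
theorem holds_of_isTest {L : ∀ j, H →L[ℝ] E j} (hL : ∀ j, Function.Surjective (L j)) {p : ι → ℝ}
    (hp : ∀ j, 0 ≤ p j) {K : ℝ≥0∞} (hK : K ≠ ∞)
    (h : ∀ f : ∀ j, E j → ℝ, (∀ j, IsTest (f j)) →
      ∫⁻ x : H, ∏ j, ENNReal.ofReal (f j (L j x)) ^ p j
        ≤ K * ∏ j, ENNReal.ofReal (∫ y, f j y) ^ p j) : Holds L p K := by
  intro f hf hfi
  choose g b hg hae hgb hb using fun j => exists_isTest_tendsto (hf j) (hfi j)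
  -- A surjective linear map pulls null sets back to null sets, its image of Lebesgue measure being
  -- a multiple of Lebesgue measure.
  have hae' : ∀ᵐ x : H, ∀ j, Tendsto (fun k => g j k (L j x)) atTop (𝓝 (f j (L j x))) := by
    refine ae_all_iff.2 fun j => ?_
    obtain ⟨c, -, hc⟩ := (L j : H →ₗ[ℝ] E j).exists_map_addHaar_eq_smul_addHaar
      (volume : Measure H) (volume : Measure (E j)) (hL j)
    have hq : Measure.QuasiMeasurePreserving (L j) (volume : Measure H) (volume : Measure (E j)) :=
      ⟨(L j).continuous.measurable, by
        have : Measure.map (L j) (volume : Measure H) = c • volume := hc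
        rw [this]; exact Measure.smul_absolutelyContinuous⟩
    exact hq.ae (hae j)
  have hlim : Tendsto (fun k => K * ∏ j, ENNReal.ofReal (b j k) ^ p j) atTop
      (𝓝 (K * ∏ j, ENNReal.ofReal (∫ y, f j y) ^ p j)) := by
    refine ENNReal.Tendsto.const_mul ?_ (Or.inr hK)
    refine ENNReal.tendsto_finsetProd_of_ne_top _ (fun j _ => ?_) fun j _ =>
      ENNReal.rpow_ne_top_of_nonneg (hp j) ENNReal.ofReal_ne_top
    exact ((ENNReal.continuous_rpow_const).tendsto _).comp (ENNReal.tendsto_ofReal (hb j))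
  calc ∫⁻ x : H, ∏ j, ENNReal.ofReal (f j (L j x)) ^ p j
      = ∫⁻ x : H, liminf (fun k => ∏ j, ENNReal.ofReal (g j k (L j x)) ^ p j) atTop := by
        refine lintegral_congr_ae ?_
        filter_upwards [hae'] with x hx
        refine (Tendsto.liminf_eq ?_).symm
        refine ENNReal.tendsto_finsetProd_of_ne_top _ (fun j _ => ?_) fun j _ =>
          ENNReal.rpow_ne_top_of_nonneg (hp j) ENNReal.ofReal_ne_top
        exact ((ENNReal.continuous_rpow_const).tendsto _).comp (ENNReal.tendsto_ofReal (hx j))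
    _ ≤ liminf (fun k => ∫⁻ x : H, ∏ j, ENNReal.ofReal (g j k (L j x)) ^ p j) atTop :=
        lintegral_liminf_le fun k => measurable_prod_ofReal_rpow L fun j => hg j k
    _ ≤ liminf (fun k => K * ∏ j, ENNReal.ofReal (b j k) ^ p j) atTop := by
        refine liminf_le_liminf (Eventually.of_forall fun k => ?_)
        refine (h _ fun j => hg j k).trans ?_
        gcongr with j
        · exact hp j
        · exact hgb j k
    _ = _ := hlim.liminf_eq

/-- Local boundedness of the Brascamp-Lieb constant near a datum where it is finite. -/
theorem exists_eventually_BL_le {L₀ : ∀ j, H →L[ℝ] E j} {p : ι → ℝ} (h₀ : IsDatum L₀ p)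
    (hBL : BL L₀ p < ∞) :
    ∃ C : ℝ≥0, ∀ᶠ L in 𝓝 L₀, IsDatum L p ∧ BL L p ≤ C := by
  have hp : ∀ j, 0 ≤ p j := fun j => (h₀.2 j).1
  obtain ⟨C₀, hC₀, hC₀lt⟩ := sInf_lt_iff.1 hBL
  obtain ⟨C₁, -, hC₁⟩ := exists_diagonalBound_of_holds hp h₀.1 hC₀lt.ne hC₀
  have hdet₀ : ∀ j, (toMat (L₀ j) * (toMat (L₀ j))ᵀ).det ≠ 0 := fun j =>
    (surjective_iff_det_toMat_ne_zero _).1 (h₀.1 j)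
  obtain ⟨C, hC, hev⟩ := exists_eventually_diagonalBound hp hC₁ hdet₀
  have hcont : Continuous fun (L : ∀ j, H →L[ℝ] E j) j => toMat (L j) :=
    continuous_pi fun j => continuous_toMat.comp (continuous_apply j)
  have hdetc : ∀ j, Continuous fun L : ∀ j, H →L[ℝ] E j =>
      (toMat (L j) * (toMat (L j))ᵀ).det := fun j => by
    have h1 : Continuous fun L : ∀ j, H →L[ℝ] E j => toMat (L j) :=
      continuous_toMat.comp (continuous_apply j)
    exact (h1.matrix_mul h1.matrix_transpose).matrix_det
  have hev1 := (hcont.tendsto L₀).eventually hev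
  have hev2 : ∀ᶠ L in 𝓝 L₀, ∀ j, (toMat (L j) * (toMat (L j))ᵀ).det ≠ 0 :=
    eventually_all.2 fun j => (hdetc j).continuousAt.eventually_ne (hdet₀ j)
  -- The added 1 leaves room for the sum, which is continuous at L₀, to vary in a neighbourhood.
  set D := ∑ j, p j * Real.log (toMat (L₀ j) * (toMat (L₀ j))ᵀ).det + 1 with hD
  have hev3 : ∀ᶠ L in 𝓝 L₀,
      ∑ j, p j * Real.log (toMat (L j) * (toMat (L j))ᵀ).det ≤ D := by
    have : ContinuousAt (fun L : ∀ j, H →L[ℝ] E j =>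
        ∑ j, p j * Real.log (toMat (L j) * (toMat (L j))ᵀ).det) L₀ :=
      tendsto_finsetSum _ fun j _ =>
        ((hdetc j).continuousAt.log (hdet₀ j)).tendsto.const_mul (p j)
    exact this.tendsto.eventually_le_const (by linarith)
  refine ⟨((gaussianPeak H)⁻¹ * Real.exp (1 / 2) * Real.exp ((Module.finrank ℝ H *
    (2 * (|Real.log C| + |D|)) + |Real.log C|) / 2)).toNNReal, ?_⟩
  filter_upwards [hev1, hev2, hev3] with L h1 h2 h3
  have hsurj : ∀ j, Function.Surjective (L j) := fun j =>
    (surjective_iff_det_toMat_ne_zero _).2 (h2 j)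
  exact ⟨⟨hsurj, h₀.2⟩, sInf_le (holds_of_isTest hsurj hp ENNReal.coe_ne_top fun f hf =>
    lintegral_prod_rpow_le_of_diagonalBound hp hC h2 h1 h3 hf)⟩

end Sufficiency

end

end BrascampLieb

theorem theorem1p1 {ι : Type*} [Fintype ι]
    {H : Type*} [NormedAddCommGroup H] [InnerProductSpace ℝ H] [FiniteDimensional ℝ H]
    [MeasurableSpace H] [BorelSpace H]
    {E : ι → Type*} [∀ j, NormedAddCommGroup (E j)] [∀ j, InnerProductSpace ℝ (E j)]
    [∀ j, FiniteDimensional ℝ (E j)] [∀ j, MeasurableSpace (E j)] [∀ j, BorelSpace (E j)]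
    (p : ι → ℝ) :
    (∀ L₀ : ∀ j, H →L[ℝ] E j, BrascampLieb.IsDatum L₀ p → BrascampLieb.BL L₀ p < ∞ →
      ∃ δ : ℝ, 0 < δ ∧ ∃ C : ℝ≥0, ∀ L : ∀ j, H →L[ℝ] E j, ‖L - L₀‖ < δ →
        BrascampLieb.BL L p ≤ C) ∧
    IsOpen (BrascampLieb.finitenessSet H E p) := by
  constructor
  · intro L₀ h₀ hBL
    obtain ⟨C, hC⟩ := BrascampLieb.exists_eventually_BL_le h₀ hBL
    -- The norm on tuples is the maximum of the operator norms, and its balls form a basis of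
    -- neighbourhoods in the product topology.
    obtain ⟨δ, hδ, hball⟩ := Metric.eventually_nhds_iff.1 hC
    exact ⟨δ, hδ, C, fun L hL => (hball (by rwa [dist_eq_norm])).2⟩
  · rw [isOpen_iff_mem_nhds]
    rintro L₀ ⟨h₀, hBL⟩
    obtain ⟨C, hC⟩ := BrascampLieb.exists_eventually_BL_le h₀ hBL
    filter_upwards [hC] with L hL
    exact ⟨hL.1, hL.2.trans_lt ENNReal.coe_lt_top⟩
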